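/- Let $m,n\ge 1$ and let $\mathfrak n=\mathfrak v\oplus\mathfrak z$ be a generalised Heisenberg algebra with $\dim\mathfrak v=n$, $\dim\mathfrak z=m$: a real Lie algebra with an inner product for which $\mathfrak v\perp\mathfrak z$, such that $\mathfrak z$ is central, $[\mathfrak v,\mathfrak v]\subset\mathfrak z$, and the operators $J_\zeta$ on $\mathfrak v$ defined by $\langle J_\zeta u,w\rangle=\langle[u,w],\zeta\rangle$ satisfy $J_\zeta^2=-|\zeta|^2\,\mathrm{id}$ for all $\zeta\in\mathfrak z$. Let $\mathcal H_{m,n}$ be the simply connected Lie group with Lie algebra $\mathfrak n$, and $g_0$ the left-invariant metric defined by the inner product. (1) $g_0$ is a Ricci nilsoliton: $R_{\mu\nu}=\lambda g_{\mu\nu}+D_{\mu\nu}$ for a constant $\lambda$ and a derivation $D$ of $\mathfrak n$, extended as a left-invariant tensor field. (2) The metric solvable extension $\mathfrak s=\mathbb RA\oplus\mathfrak n$, with $A$ a unit vector orthogonal to $\mathfrak n$, $[A,u]=\tfrac12u$ for $u\in\mathfrak v$ and $[A,\zeta]=\zeta$ for $\zeta\in\mathfrak z$ (eigenvalue type $(1<2;n,m)$),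 is Einstein: the left-invariant metric that it defines on its simply connected Lie group satisfies $R_{\mu\nu}=\kappa g_{\mu\nu}$ for a constant $\kappa$. (3) There is a constant $c>0$ such that, for all real $\ell\neq0$, $\alpha$, $\beta$, $\Lambda$ with $$\alpha+\frac{n+4m}{nm}\,\beta=\ell^2,\qquad \Lambda=-\frac1{8\ell^2},$$ the rescaled metric $g=c\,\ell^2g_0$ solves the generalised Einstein equation $\Phi_{\mu\nu}+\Lambda g_{\mu\nu}=0$, where, with $\Box=\nabla^\mu\nabla_\mu$ and $R_{\mu\nu}=R^{\sigma}{}_{\mu\sigma\nu}$, $$\begin{aligned}\Phi_{\mu\nu}={}&R_{\mu\nu}-\tfrac12Rg_{\mu\nu}+2\alpha R\left(R_{\mu\nu}-\tfrac14Rg_{\mu\nu}\right)+(2\alpha+\beta)(g_{\mu\nu}\Box-\nabla_\mu\nabla_\nu)R\\&+\beta\,\Box\left(R_{\mu\nu}-\tfrac12Rg_{\mu\nu}\right)+2\beta\left(R_{\mu\sigma\nu\rho}-\tfrac14g_{\mu\nu}R_{\sigma\rho}\right)R^{\sigma\rho},\end{aligned}$$ and its action vanishes: the integral $$\int\left(R+\alpha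 R^2+\beta R_{\mu\nu}R^{\mu\nu}-2\Lambda\right)\sqrt g\,\mathrm d^{\,n+m}x$$ over $\mathcal H_{m,n}$, and over every measurable subset of it, converges absolutely and equals $0$. -/

import Mathlib

open MeasureTheory

noncomputable section

/-! ### Riemannian geometry in a global chart

The manifold is `ℝ^ι`, with coordinates `x : ι → ℝ`; a metric is given by its matrix
`g x i j = g_{ij}(x)`, and all tensors by their coordinate components.  Index conventions:
`R^i_{jkl} = ∂_k Γ^i_{lj} - ∂_l Γ^i_{kj} + Γ^i_{kp} Γ^p_{lj} - Γ^i_{lp} Γ^p_{kj}` and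
`R_{jl} = R^i_{jil}` (so that round spheres have positive Ricci curvature). -/

namespace ChartGeometry

variable {ι : Type} [Fintype ι] [DecidableEq ι]

/-- The partial derivative `∂_i f` at `x`. -/
def pd (i : ι) (f : (ι → ℝ) → ℝ) (x : ι → ℝ) : ℝ :=
  fderiv ℝ f x (Pi.single i 1)

/-- The Christoffel symbol `Γ^k_{ij}` of the Levi-Civita connection. -/
def christoffel (g : (ι → ℝ) → Matrix ι ι ℝ) (x : ι → ℝ) (k i j : ι) : ℝ :=
  (1 / 2) * ∑ l, (g x)⁻¹ k l *
    (pd i (fun y => g y j l) x + pd j (fun y => g y i l) x - pd l (fun y => g y i j) x)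

/-- The curvature tensor `R^i_{jkl}`. -/
def riemannUp (g : (ι → ℝ) → Matrix ι ι ℝ) (x : ι → ℝ) (i j k l : ι) : ℝ :=
  pd k (fun y => christoffel g y i l j) x - pd l (fun y => christoffel g y i k j) x
    + ∑ p, (christoffel g x i k p * christoffel g x p l j
        - christoffel g x i l p * christoffel g x p k j)

/-- The curvature tensor with all indices lowered, `R_{ijkl} = g_{ip} R^p_{jkl}`. -/
def riemann (g : (ι → ℝ) → Matrix ι ι ℝ) (x : ι → ℝ) (i j k l : ι) : ℝ :=
  ∑ p, g x i p * riemannUp g x p j k l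

/-- The Ricci tensor `R_{jl} = R^i_{jil}`. -/
def ricci (g : (ι → ℝ) → Matrix ι ι ℝ) (x : ι → ℝ) : Matrix ι ι ℝ :=
  Matrix.of fun j l => ∑ i, riemannUp g x i j i l

/-- The Ricci tensor with both indices raised, `R^{ij} = g^{ia} R_{ab} g^{bj}`. -/
def ricciUp (g : (ι → ℝ) → Matrix ι ι ℝ) (x : ι → ℝ) : Matrix ι ι ℝ :=
  (g x)⁻¹ * ricci g x * (g x)⁻¹

/-- The Ricci curvature scalar `R = g^{ij} R_{ij}`. -/
def scalarCurv (g : (ι → ℝ) → Matrix ι ι ℝ) (x : ι → ℝ) : ℝ :=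
  ∑ i, ∑ j, (g x)⁻¹ i j * ricci g x i j

/-- The square `R_{ij} R^{ij}` of the Ricci tensor. -/
def ricciSq (g : (ι → ℝ) → Matrix ι ι ℝ) (x : ι → ℝ) : ℝ :=
  ∑ i, ∑ j, ricci g x i j * ricciUp g x i j

/-- The second covariant derivative `∇_i ∇_j f` of a function. -/
def hessian (g : (ι → ℝ) → Matrix ι ι ℝ) (f : (ι → ℝ) → ℝ) (x : ι → ℝ) (i j : ι) : ℝ :=
  pd i (fun y => pd j f y) x - ∑ k, christoffel g x k i j * pd k f x

/-- `□ f = g^{ij} ∇_i ∇_j f` for a function. -/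
def boxFun (g : (ι → ℝ) → Matrix ι ι ℝ) (f : (ι → ℝ) → ℝ) (x : ι → ℝ) : ℝ :=
  ∑ i, ∑ j, (g x)⁻¹ i j * hessian g f x i j

/-- The covariant derivative `∇_k T_{ij}` of a tensor with two lower indices. -/
def covDeriv (g : (ι → ℝ) → Matrix ι ι ℝ) (T : (ι → ℝ) → Matrix ι ι ℝ) (x : ι → ℝ)
    (k i j : ι) : ℝ :=
  pd k (fun y => T y i j) x
    - ∑ p, (christoffel g x p k i * T x p j + christoffel g x p k j * T x i p)

/-- The second covariant derivative `∇_l ∇_k T_{ij}` of a tensor with two lower indices. -/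
def covDeriv₂ (g : (ι → ℝ) → Matrix ι ι ℝ) (T : (ι → ℝ) → Matrix ι ι ℝ) (x : ι → ℝ)
    (l k i j : ι) : ℝ :=
  pd l (fun y => covDeriv g T y k i j) x
    - ∑ p, (christoffel g x p l k * covDeriv g T x p i j
        + christoffel g x p l i * covDeriv g T x k p j
        + christoffel g x p l j * covDeriv g T x k i p)

/-- `□ T_{ij} = g^{lk} ∇_l ∇_k T_{ij}`. -/
def boxTensor (g : (ι → ℝ) → Matrix ι ι ℝ) (T : (ι → ℝ) → Matrix ι ι ℝ) (x : ι → ℝ)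
    (i j : ι) : ℝ :=
  ∑ l, ∑ k, (g x)⁻¹ l k * covDeriv₂ g T x l k i j

/-- The tensor `Φ_{μν}` of the quadratic gravity theory with parameters `α`, `β`. -/
def Phi (α β : ℝ) (g : (ι → ℝ) → Matrix ι ι ℝ) (x : ι → ℝ) (μ ν : ι) : ℝ :=
  ricci g x μ ν - (1 / 2) * scalarCurv g x * g x μ ν
    + 2 * α * scalarCurv g x * (ricci g x μ ν - (1 / 4) * scalarCurv g x * g x μ ν)
    + (2 * α + β) * (g x μ ν * boxFun g (scalarCurv g) x - hessian g (scalarCurv g) x μ ν)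
    + β * boxTensor g (fun y => ricci g y - ((1 / 2) * scalarCurv g y) • g y) x μ ν
    + 2 * β * ∑ σ, ∑ ρ,
        (riemann g x μ σ ν ρ - (1 / 4) * g x μ ν * ricci g x σ ρ) * ricciUp g x σ ρ

/-- The generalised Einstein equation `Φ_{μν} + Λ g_{μν} = 0`. -/
def GeneralisedEinstein (α β Λ : ℝ) (g : (ι → ℝ) → Matrix ι ι ℝ) : Prop :=
  ∀ (x : ι → ℝ) (μ ν : ι), Phi α β g x μ ν + Λ * g x μ ν = 0

/-- The integrand `(R + α R² + β R_{μν} R^{μν} - 2 Λ) √g` of the action. -/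
def actionDensity (α β Λ : ℝ) (g : (ι → ℝ) → Matrix ι ι ℝ) (x : ι → ℝ) : ℝ :=
  (scalarCurv g x + α * scalarCurv g x ^ 2 + β * ricciSq g x - 2 * Λ) * √(g x).det

/-- The action of the metric `g` over the region `D` is a convergent integral with value `S`. -/
def HasAction (α β Λ : ℝ) (g : (ι → ℝ) → Matrix ι ι ℝ) (D : Set (ι → ℝ)) (S : ℝ) : Prop :=
  IntegrableOn (actionDensity α β Λ g) D ∧ ∫ x in D, actionDensity α β Λ g x = S

/-- The metric `g` is Einstein: `R_{μν} = κ g_{μν}` for a constant `κ`. -/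
def IsEinstein (g : (ι → ℝ) → Matrix ι ι ℝ) : Prop :=
  ∃ κ : ℝ, ∀ x : ι → ℝ, ricci g x = κ • g x

/-- For a group law `mul` with inverse `inv` on `ℝ^ι`, the matrix at `x` of the differential
`T_x → T_e` of the left translation by `x⁻¹`.  Its rows are left-invariant one-forms. -/
def leftCoframe (mul : (ι → ℝ) → (ι → ℝ) → (ι → ℝ)) (inv : (ι → ℝ) → (ι → ℝ))
    (x : ι → ℝ) : Matrix ι ι ℝ :=
  Matrix.of fun a i => pd i (fun y => mul (inv x) y a) x

/-- The left-invariant metric for which the above left-invariant coframe is orthonormal. -/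
def leftInvariantMetric (mul : (ι → ℝ) → (ι → ℝ) → (ι → ℝ)) (inv : (ι → ℝ) → (ι → ℝ))
    (x : ι → ℝ) : Matrix ι ι ℝ :=
  (leftCoframe mul inv x).transpose * leftCoframe mul inv x

end ChartGeometry

/-- A generalised Heisenberg algebra `𝔫 = 𝔳 ⊕ 𝔷` (orthogonal sum, `dim 𝔳 = n`, `dim 𝔷 = m`),
in orthonormal bases `e_i` of `𝔳` and `z_k` of `𝔷`.  The bracket is
`[e_i, e_j] = ∑ k, C k i j • z_k`, and `𝔷` is central.  The operator `J_ζ` on `𝔳` defined by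
`⟨J_ζ u, w⟩ = ⟨[u, w], ζ⟩` has the matrix `∑ k, ζ k • (C k)ᵀ`, and it is required that
`J_ζ² = -|ζ|² id` for all `ζ`. -/
structure GeneralisedHeisenberg (m n : ℕ) where
  C : Fin m → Matrix (Fin n) (Fin n) ℝ
  skew : ∀ k i j, C k i j = - C k j i
  J_sq : ∀ ζ : Fin m → ℝ,
    (∑ k, ζ k • (C k).transpose) * (∑ k, ζ k • (C k).transpose)
      = -(∑ k, ζ k ^ 2) • (1 : Matrix (Fin n) (Fin n) ℝ)

namespace GeneralisedHeisenberg

open ChartGeometry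

variable {m n : ℕ} (H : GeneralisedHeisenberg m n)

/-- The `𝔷`-component of the bracket of two vectors in `𝔳`. -/
def bracketV (u w : Fin n → ℝ) : Fin m → ℝ :=
  fun k => ∑ i, ∑ j, H.C k i j * u i * w j

/-- The Lie bracket of `𝔫 = 𝔳 ⊕ 𝔷`. -/
def bracket (X Y : Fin n ⊕ Fin m → ℝ) : Fin n ⊕ Fin m → ℝ :=
  Sum.elim 0 (H.bracketV (X ∘ Sum.inl) (Y ∘ Sum.inl))

/-- The simply connected group with Lie algebra `𝔫`, in exponential coordinates:
`x · y = x + y + ½ [x, y]`. -/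
def mul (x y : Fin n ⊕ Fin m → ℝ) : Fin n ⊕ Fin m → ℝ :=
  x + y + (1 / 2 : ℝ) • H.bracket x y

/-- The left-invariant metric of the generalised Heisenberg group. -/
def metric : (Fin n ⊕ Fin m → ℝ) → Matrix (Fin n ⊕ Fin m) (Fin n ⊕ Fin m) ℝ :=
  leftInvariantMetric H.mul (fun x => -x)

/-- The metric is a Ricci nilsoliton: `R_{μν} = λ g_{μν} + D_{μν}`, where `D` is a
derivation of `𝔫` (extended to a left-invariant tensor field). -/
def IsNilsoliton : Prop :=
  ∃ (lam : ℝ) (D : Matrix (Fin n ⊕ Fin m) (Fin n ⊕ Fin m) ℝ),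
    (∀ X Y, D.mulVec (H.bracket X Y)
      = H.bracket (D.mulVec X) Y + H.bracket X (D.mulVec Y)) ∧
    ∀ x, ricci H.metric x = lam • H.metric x +
      (leftCoframe H.mul (fun x => -x) x).transpose * D *
        leftCoframe H.mul (fun x => -x) x

/-- The group law of the solvable extension `𝔰 = ℝ A ⊕ 𝔫` with `[A, U] = ½ U` for `U ∈ 𝔳` and
`[A, Z] = Z` for `Z ∈ 𝔷`; the eigenvalues of `ad A` on `𝔫` are in the ratio `1 : 2`, with
multiplicities `n` and `m`.  The coordinate along `A` is the one indexed by `Sum.inl ()`, and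
`(s, u, z) · (s', u', z') = (s + s', u + e^{s/2} u', z + e^s z' + ½ e^{s/2} [u, u'])`. -/
def extMul (x y : Unit ⊕ (Fin n ⊕ Fin m) → ℝ) : Unit ⊕ (Fin n ⊕ Fin m) → ℝ :=
  Sum.elim (fun _ => x (.inl ()) + y (.inl ()))
    (Sum.elim
      (fun i => x (.inr (.inl i)) + Real.exp (x (.inl ()) / 2) * y (.inr (.inl i)))
      (fun k => x (.inr (.inr k)) + Real.exp (x (.inl ())) * y (.inr (.inr k))
        + (1 / 2) * Real.exp (x (.inl ()) / 2) *
          H.bracketV (fun i => x (.inr (.inl i))) (fun i => y (.inr (.inl i))) k))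

/-- The inverse for the group law of the solvable extension. -/
def extInv (x : Unit ⊕ (Fin n ⊕ Fin m) → ℝ) : Unit ⊕ (Fin n ⊕ Fin m) → ℝ :=
  Sum.elim (fun _ => - x (.inl ()))
    (Sum.elim
      (fun i => - (Real.exp (- x (.inl ()) / 2) * x (.inr (.inl i))))
      (fun k => - (Real.exp (- x (.inl ())) * x (.inr (.inr k)))))

/-- The left-invariant metric of the solvable extension: `A` is a unit vector orthogonal
to `𝔫`. -/
def extMetric : (Unit ⊕ (Fin n ⊕ Fin m) → ℝ) →
    Matrix (Unit ⊕ (Fin n ⊕ Fin m)) (Unit ⊕ (Fin n ⊕ Fin m)) ℝ :=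
  leftInvariantMetric H.extMul extInv

end GeneralisedHeisenberg

end

/-!
All three claims reduce to algebra in a left-invariant orthonormal frame.  Let `E x` be the
component matrix of a coframe on `ℝ^ι` whose Levi-Civita connection has constant coefficients
`ω` (`IsInvariantCoframe`), and let `g = κ EᵀE`.  In the gauge given by `E` the Christoffel
symbols satisfy `E Γ_i = ∂_i E + Ω_i E`, where `Ω_i` is the connection form
(`christoffelMat_eq`).  Differentiating this identity shows that the curvature is the constant
frame tensor `frameCurv ω` (`mul_riemannUp`), and likewise covariant derivatives of tensors
`EᵀtE` with constant `t` are of the same form (`covDeriv_eq`, `covDeriv₂_eq`).  So the Ricci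
tensor, the scalar curvature and the tensor `Φ` are given by constant matrices (`ricci_eq`,
`scalarCurv_eq`, `Phi_eq`).

For a generalised Heisenberg algebra the Clifford relations `C_k C_l + C_l C_k = -2 δ_kl` make
every symmetric frame tensor that occurs a scalar `p` on `𝔳` and a scalar `q` on `𝔷`
(`blockScalar`).  The Ricci tensor has `p = -m/2`, `q = n/4` (`frameRicci_conn`), which equals
`λ + D` with `λ = -(m + n/4)` and `D = (m + n/2) diag(1/2, 1)`, a multiple of the grading
derivation.

For the extension by a diagonal derivation `diag d`, the coframe is `ds, e^{-d_a s} θ^a`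
(`IsInvariantCoframe.ext`), and its Ricci tensor is `-tr d²` on `A` and `Ric - tr(d) diag d` on
`𝔫` (`frameRicci_extConn`).  For `d = (1/2, 1)` one has `tr d = m + n/2` and
`tr d² = m + n/4 = -λ`, so the extension is Einstein with constant `λ`.

For the metric `c ℓ² g₀` the Lagrangian is `ℓ⁻² (nm/(4c) - 1/2)²`, which vanishes at
`c = nm/2`.  For the same `c` both eigenvalues of `Φ + Λ g` vanish, by `frameBox_blockScalar`
and `frameCurvAct_blockScalar`.
-/

noncomputable section

namespace ChartGeometry

open Matrix

set_option linter.unusedSectionVars false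

variable {ι : Type} [Fintype ι] [DecidableEq ι]

/-! ### Partial derivatives of matrix-valued functions -/

lemma pd_const (i : ι) (c : ℝ) (x : ι → ℝ) : pd i (fun _ => c) x = 0 := by
  simp [pd]

lemma pd_add {i : ι} {f h : (ι → ℝ) → ℝ} {x : ι → ℝ} (hf : DifferentiableAt ℝ f x)
    (hh : DifferentiableAt ℝ h x) : pd i (fun y => f y + h y) x = pd i f x + pd i h x := by
  simp [pd, fderiv_fun_add hf hh]

lemma pd_mul {i : ι} {f h : (ι → ℝ) → ℝ} {x : ι → ℝ} (hf : DifferentiableAt ℝ f x)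
    (hh : DifferentiableAt ℝ h x) :
    pd i (fun y => f y * h y) x = pd i f x * h x + f x * pd i h x := by
  simp [pd, fderiv_fun_mul hf hh]; ring

lemma pd_sum {κ : Type*} {s : Finset κ} {i : ι} {f : κ → (ι → ℝ) → ℝ} {x : ι → ℝ}
    (hf : ∀ a ∈ s, DifferentiableAt ℝ (f a) x) :
    pd i (fun y => ∑ a ∈ s, f a y) x = ∑ a ∈ s, pd i (f a) x := by
  simp [pd, fderiv_fun_sum hf]

lemma pd_comm {f : (ι → ℝ) → ℝ} (hf : ContDiff ℝ 2 f) (i j : ι) (x : ι → ℝ) :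
    pd i (fun y => pd j f y) x = pd j (fun y => pd i f y) x := by
  have hd : DifferentiableAt ℝ (fderiv ℝ f) x :=
    ((hf.fderiv_right (m := 1) (by norm_num)).differentiable (by norm_num)) x
  have hs : IsSymmSndFDerivAt ℝ f x :=
    hf.contDiffAt.isSymmSndFDerivAt (by simp)
  have key : ∀ v w : ι → ℝ, fderiv ℝ (fun y => fderiv ℝ f y v) x w
      = fderiv ℝ (fderiv ℝ f) x w v := by
    intro v w
    rw [fderiv_clm_apply hd (differentiableAt_const v)]
    simp
  simp only [pd, key]
  exact hs _ _

lemma differentiable_pd {f : (ι → ℝ) → ℝ} (hf : ContDiff ℝ 2 f) (i : ι) :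
    Differentiable ℝ (fun y => pd i f y) :=
  ((hf.fderiv_right (m := 1) (by norm_num)).differentiable (by norm_num)).clm_apply
    (differentiable_const _)

lemma pd_proj (i j : ι) (x : ι → ℝ) : pd i (fun y => y j) x = if j = i then 1 else 0 := by
  have : (fun y : ι → ℝ => y j) = ContinuousLinearMap.proj (R := ℝ) j := rfl
  rw [pd, this, ContinuousLinearMap.fderiv]
  simp [Pi.single_apply]

lemma pd_exp (i j : ι) (c : ℝ) (x : ι → ℝ) :
    pd i (fun y => Real.exp (c * y j)) x = if j = i then c * Real.exp (c * x j) else 0 := by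
  have h1 : pd i (fun y => c * y j) x = c * (if j = i then 1 else 0) := by
    rw [pd_mul (by fun_prop) (by fun_prop), pd_const, pd_proj]; ring
  have h2 : DifferentiableAt ℝ (fun y : ι → ℝ => c * y j) x := by fun_prop
  rw [pd, fderiv_exp h2, _root_.smul_apply, smul_eq_mul,
    show fderiv ℝ (fun y : ι → ℝ => c * y j) x (Pi.single i 1)
      = c * (if j = i then 1 else 0) from h1]
  split_ifs <;> ring

/-- The entrywise partial derivative of a matrix-valued function. -/
def pdMat (i : ι) (M : (ι → ℝ) → Matrix ι ι ℝ) (x : ι → ℝ) : Matrix ι ι ℝ :=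
  Matrix.of fun a b => pd i (fun y => M y a b) x

/-- Entrywise differentiability of a matrix-valued function; it avoids the choice of a norm on
matrices. -/
def EntrywiseDifferentiable (M : (ι → ℝ) → Matrix ι ι ℝ) : Prop :=
  ∀ a b, Differentiable ℝ fun x => M x a b

lemma EntrywiseDifferentiable.mul {M N : (ι → ℝ) → Matrix ι ι ℝ}
    (hM : EntrywiseDifferentiable M) (hN : EntrywiseDifferentiable N) :
    EntrywiseDifferentiable fun x => M x * N x := by
  intro a b
  simp only [Matrix.mul_apply]
  exact Differentiable.fun_sum fun p _ => (hM a p).mul (hN p b)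

lemma EntrywiseDifferentiable.add {M N : (ι → ℝ) → Matrix ι ι ℝ}
    (hM : EntrywiseDifferentiable M) (hN : EntrywiseDifferentiable N) :
    EntrywiseDifferentiable fun x => M x + N x :=
  fun a b => (hM a b).add (hN a b)

lemma EntrywiseDifferentiable.transpose {M : (ι → ℝ) → Matrix ι ι ℝ}
    (hM : EntrywiseDifferentiable M) : EntrywiseDifferentiable fun x => (M x)ᵀ :=
  fun a b => hM b a

lemma EntrywiseDifferentiable.const (A : Matrix ι ι ℝ) :
    EntrywiseDifferentiable fun _ => A :=
  fun _ _ => differentiable_const _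

lemma pdMat_mul {M N : (ι → ℝ) → Matrix ι ι ℝ}
    (hM : EntrywiseDifferentiable M) (hN : EntrywiseDifferentiable N) (i : ι) (x : ι → ℝ) :
    pdMat i (fun y => M y * N y) x = pdMat i M x * N x + M x * pdMat i N x := by
  ext a b
  simp only [pdMat, Matrix.of_apply, Matrix.add_apply, Matrix.mul_apply]
  have hd : ∀ p ∈ Finset.univ, DifferentiableAt ℝ (fun y => M y a p * N y p b) x :=
    fun p _ => (hM a p x).mul (hN p b x)
  rw [pd_sum hd, ← Finset.sum_add_distrib]
  exact Finset.sum_congr rfl fun p _ => pd_mul (hM a p x) (hN p b x)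

lemma pdMat_add {M N : (ι → ℝ) → Matrix ι ι ℝ}
    (hM : EntrywiseDifferentiable M) (hN : EntrywiseDifferentiable N) (i : ι) (x : ι → ℝ) :
    pdMat i (fun y => M y + N y) x = pdMat i M x + pdMat i N x := by
  ext a b
  exact pd_add (hM a b x) (hN a b x)

lemma pdMat_const (A : Matrix ι ι ℝ) (i : ι) (x : ι → ℝ) : pdMat i (fun _ => A) x = 0 := by
  ext a b
  exact pd_const i _ x

lemma pdMat_transpose (M : (ι → ℝ) → Matrix ι ι ℝ) (i : ι) (x : ι → ℝ) :
    pdMat i (fun y => (M y)ᵀ) x = (pdMat i M x)ᵀ := rfl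

/-! ### Coframes with constant connection coefficients -/

/-- The matrix of the connection one-form `ω^a_c = ω^a_{bc} θ^b` on the coordinate vector `∂_i`,
for the coframe `θ` with component matrix `E` and connection coefficients
`ω b a c = ω^a_{bc}`. -/
def connForm (ω : ι → Matrix ι ι ℝ) (E : Matrix ι ι ℝ) (i : ι) : Matrix ι ι ℝ :=
  ∑ b, E b i • ω b

/-- `E x` is the component matrix of a coframe (rows are one-forms) with inverse `F x`, and the
constants `ω b a c = ⟨∇_{e_b} e_c, e_a⟩` are the coefficients of a metric torsion-free
connection: they are skew in `a`, `c`, and `dθ^a + ω^a_c ∧ θ^c = 0`.  Left-invariant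
coframes of a Lie group structure on `ℝ^ι` are of this kind. -/
structure IsInvariantCoframe (E F : (ι → ℝ) → Matrix ι ι ℝ) (ω : ι → Matrix ι ι ℝ) :
    Prop where
  contDiff : ∀ a i, ContDiff ℝ 2 fun x => E x a i
  diff_inv : EntrywiseDifferentiable F
  inv_mul : ∀ x, F x * E x = 1
  skew : ∀ b, (ω b)ᵀ = -ω b
  torsion : ∀ x a i j, (pdMat i E x + connForm ω (E x) i * E x) a j
    = (pdMat j E x + connForm ω (E x) j * E x) a i

/-- The curvature operator `R(e_c, e_d)` in the frame, as a matrix. -/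
def frameCurv (ω : ι → Matrix ι ι ℝ) (c d : ι) : Matrix ι ι ℝ :=
  ω c * ω d - ω d * ω c - ∑ p, (ω c p d - ω d p c) • ω p

/-- The components of the Ricci tensor in the frame. -/
def frameRicci (ω : ι → Matrix ι ι ℝ) : Matrix ι ι ℝ :=
  Matrix.of fun b d => ∑ a, frameCurv ω a d a b

/-- The frame components of `∇_{e_c} T`, for an invariant tensor `T` with frame components `t`. -/
def frameCov (ω : ι → Matrix ι ι ℝ) (t : Matrix ι ι ℝ) (c : ι) : Matrix ι ι ℝ :=
  ω c * t - t * ω c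

/-- The frame components of the rough Laplacian of an invariant tensor with frame components `t`,
for the metric in which the frame is orthonormal. -/
def frameBox (ω : ι → Matrix ι ι ℝ) (t : Matrix ι ι ℝ) : Matrix ι ι ℝ :=
  ∑ c, (frameCov ω (frameCov ω t c) c - ∑ p, ω c p c • frameCov ω t p)

/-- The contraction `R_{abcd} t^{bd}` in the frame. -/
def frameCurvAct (ω : ι → Matrix ι ι ℝ) (t : Matrix ι ι ℝ) : Matrix ι ι ℝ :=
  Matrix.of fun a c => ∑ b, ∑ d, frameCurv ω c d a b * t b d

/-- The coordinate matrix `Γ_i = (Γ^k_{ij})_{k,j}` of the Levi-Civita connection. -/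
def christoffelMat (g : (ι → ℝ) → Matrix ι ι ℝ) (i : ι) (x : ι → ℝ) : Matrix ι ι ℝ :=
  Matrix.of fun k j => christoffel g x k i j

namespace IsInvariantCoframe

variable {E F : (ι → ℝ) → Matrix ι ι ℝ} {ω : ι → Matrix ι ι ℝ} {κ : ℝ}

lemma diff (h : IsInvariantCoframe E F ω) : EntrywiseDifferentiable E :=
  fun a i => (h.contDiff a i).differentiable (by norm_num)

lemma mul_inv (h : IsInvariantCoframe E F ω) (x : ι → ℝ) : E x * F x = 1 :=
  mul_eq_one_comm.mp (h.inv_mul x)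

lemma diff_pdMat (h : IsInvariantCoframe E F ω) (i : ι) :
    EntrywiseDifferentiable (pdMat i E) :=
  fun a j => differentiable_pd (h.contDiff a j) i

lemma diff_connForm (h : IsInvariantCoframe E F ω) (i : ι) :
    EntrywiseDifferentiable (fun x => connForm ω (E x) i) := by
  intro a c
  simp only [connForm, Matrix.sum_apply, Matrix.smul_apply, smul_eq_mul]
  exact Differentiable.fun_sum fun b _ => (h.diff b i).mul_const _

lemma connForm_transpose (h : IsInvariantCoframe E F ω) (x : ι → ℝ) (i : ι) :
    (connForm ω (E x) i)ᵀ = -connForm ω (E x) i := by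
  simp [connForm, Matrix.transpose_sum, h.skew]

lemma pdMat_comm (h : IsInvariantCoframe E F ω) (i j : ι) (x : ι → ℝ) :
    pdMat i (pdMat j E) x = pdMat j (pdMat i E) x := by
  ext a b
  exact pd_comm (h.contDiff a b) i j x

lemma metric_inv (h : IsInvariantCoframe E F ω) (hκ : κ ≠ 0) (x : ι → ℝ) :
    (κ • ((E x)ᵀ * E x))⁻¹ = κ⁻¹ • (F x * (F x)ᵀ) := by
  apply Matrix.inv_eq_left_inv
  have h1 : (F x)ᵀ * (E x)ᵀ = 1 := by
    rw [← Matrix.transpose_mul, h.mul_inv, Matrix.transpose_one]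
  rw [Matrix.smul_mul, Matrix.mul_smul, smul_smul, inv_mul_cancel₀ hκ, one_smul,
    Matrix.mul_assoc, ← Matrix.mul_assoc (F x)ᵀ, h1, Matrix.one_mul, h.inv_mul]

/-- The Levi-Civita connection of an invariant metric, in the gauge given by the coframe. -/
lemma christoffelMat_eq (h : IsInvariantCoframe E F ω) (hκ : κ ≠ 0) (i : ι) (x : ι → ℝ) :
    christoffelMat (fun y => κ • ((E y)ᵀ * E y)) i x
      = F x * (pdMat i E x + connForm ω (E x) i * E x) := by
  set D : ι → Matrix ι ι ℝ := fun i => pdMat i E x + connForm ω (E x) i * E x with hD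
  have hsym : ∀ a i j, D i a j = D j a i := h.torsion x
  -- The connection forms are skew, so the derivative of the metric is a product rule with `D i`.
  have hpd : ∀ i j l, pd i (fun y => (κ • ((E y)ᵀ * E y)) j l) x
      = κ * (((D i)ᵀ * E x) j l + ((E x)ᵀ * D i) j l) := by
    intro i j l
    have h1 : pdMat i (fun y => (E y)ᵀ * E y) x = (D i)ᵀ * E x + (E x)ᵀ * D i := by
      rw [pdMat_mul h.diff.transpose h.diff, pdMat_transpose]
      simp only [hD, Matrix.transpose_add, Matrix.transpose_mul, h.connForm_transpose,
        Matrix.add_mul, Matrix.mul_add, Matrix.mul_neg, Matrix.neg_mul, Matrix.mul_assoc]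
      abel
    have h2 : pd i (fun y => ((E y)ᵀ * E y) j l) x
        = ((D i)ᵀ * E x) j l + ((E x)ᵀ * D i) j l :=
      congrFun (congrFun h1 j) l
    simp only [Matrix.smul_apply, smul_eq_mul]
    rw [pd_mul (differentiableAt_const κ) ((h.diff.transpose.mul h.diff) j l x), pd_const, h2]
    ring
  have hS : ∀ i j l, ((D i)ᵀ * E x) j l = ((E x)ᵀ * D i) l j := by
    intro i j l
    simp [Matrix.mul_apply, mul_comm]
  have hSsym : ∀ i j l, ((E x)ᵀ * D i) l j = ((E x)ᵀ * D j) l i := by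
    intro i j l
    simp only [Matrix.mul_apply, hsym _ i j]
  ext k j
  have hFE : (F x)ᵀ * (E x)ᵀ = 1 := by
    rw [← Matrix.transpose_mul, h.mul_inv, Matrix.transpose_one]
  have hprod : F x * D i = κ⁻¹ • (F x * (F x)ᵀ) * (κ • ((E x)ᵀ * D i)) := by
    rw [Matrix.smul_mul, Matrix.mul_smul, smul_smul, inv_mul_cancel₀ hκ, one_smul,
      Matrix.mul_assoc, ← Matrix.mul_assoc (F x)ᵀ, hFE, Matrix.one_mul]
  rw [hprod, Matrix.mul_apply]
  simp only [christoffelMat, christoffel, Matrix.of_apply, h.metric_inv hκ, hpd, hS]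
  rw [Finset.mul_sum]
  refine Finset.sum_congr rfl fun l _ => ?_
  rw [hSsym j i l, hSsym i l j, hSsym j l i, Matrix.smul_apply (κ) ((E x)ᵀ * D i), smul_eq_mul]
  ring

lemma mul_christoffelMat (h : IsInvariantCoframe E F ω) (hκ : κ ≠ 0) (i : ι) (x : ι → ℝ) :
    E x * christoffelMat (fun y => κ • ((E y)ᵀ * E y)) i x
      = pdMat i E x + connForm ω (E x) i * E x := by
  rw [h.christoffelMat_eq hκ, ← Matrix.mul_assoc, h.mul_inv, Matrix.one_mul]

lemma diff_christoffelMat (h : IsInvariantCoframe E F ω) (hκ : κ ≠ 0) (i : ι) :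
    EntrywiseDifferentiable (christoffelMat (fun y => κ • ((E y)ᵀ * E y)) i) := by
  have : christoffelMat (fun y => κ • ((E y)ᵀ * E y)) i
      = fun x => F x * (pdMat i E x + connForm ω (E x) i * E x) :=
    funext fun x => h.christoffelMat_eq hκ i x
  rw [this]
  exact h.diff_inv.mul ((h.diff_pdMat i).add ((h.diff_connForm i).mul h.diff))

/-! ### Curvature of invariant metrics -/

/-- The exterior derivative of the connection form, by the structure equation. -/
lemma pdMat_connForm_sub (h : IsInvariantCoframe E F ω) (k l : ι) (x : ι → ℝ) :
    pdMat k (fun y => connForm ω (E y) l) x - pdMat l (fun y => connForm ω (E y) k) x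
      = -∑ c, ∑ d, (E x c k * E x d l) • ∑ p, (ω c p d - ω d p c) • ω p := by
  have h1 : ∀ k l, pdMat k (fun y => connForm ω (E y) l) x = ∑ p, pdMat k E x p l • ω p := by
    intro k l
    ext a c
    simp only [pdMat, connForm, Matrix.sum_apply, Matrix.smul_apply, smul_eq_mul, Matrix.of_apply]
    rw [pd_sum fun b _ => (h.diff b l x).mul_const _]
    refine Finset.sum_congr rfl fun b _ => ?_
    rw [pd_mul (h.diff b l x) (differentiableAt_const _), pd_const, mul_zero, add_zero]
  have h2 : ∀ p, pdMat k E x p l - pdMat l E x p k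
      = -∑ c, ∑ d, (E x c k * E x d l) * (ω c p d - ω d p c) := by
    intro p
    have ht := h.torsion x p k l
    have e1 : (connForm ω (E x) k * E x) p l = ∑ c, ∑ d, (E x c k * E x d l) * ω c p d := by
      simp only [connForm, Matrix.mul_apply, Matrix.sum_apply, Matrix.smul_apply, smul_eq_mul,
        Finset.sum_mul]
      rw [Finset.sum_comm]
      exact Finset.sum_congr rfl fun c _ => Finset.sum_congr rfl fun d _ => by ring
    have e2 : (connForm ω (E x) l * E x) p k = ∑ c, ∑ d, (E x c k * E x d l) * ω d p c := by
      simp only [connForm, Matrix.mul_apply, Matrix.sum_apply, Matrix.smul_apply, smul_eq_mul,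
        Finset.sum_mul]
      exact Finset.sum_congr rfl fun c _ => Finset.sum_congr rfl fun d _ => by ring
    simp only [Matrix.add_apply, e1, e2] at ht
    simp only [mul_sub, Finset.sum_sub_distrib]
    linarith
  rw [h1, h1, ← Finset.sum_sub_distrib]
  simp only [← sub_smul, h2, Finset.smul_sum, smul_smul, neg_smul, Finset.sum_neg_distrib,
    Finset.sum_smul]
  congr 1
  rw [Finset.sum_comm]
  exact Finset.sum_congr rfl fun c _ => Finset.sum_comm

/-- The coframe intertwines the coordinate curvature with the constant frame curvature. -/
lemma mul_riemannUp (h : IsInvariantCoframe E F ω) (hκ : κ ≠ 0) (k l : ι) (x : ι → ℝ) :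
    E x * Matrix.of (fun i j => riemannUp (fun y => κ • ((E y)ᵀ * E y)) x i j k l)
      = (∑ c, ∑ d, (E x c k * E x d l) • frameCurv ω c d) * E x := by
  set g : (ι → ℝ) → Matrix ι ι ℝ := fun y => κ • ((E y)ᵀ * E y) with hg
  have hR : Matrix.of (fun i j => riemannUp g x i j k l)
      = pdMat k (christoffelMat g l) x - pdMat l (christoffelMat g k) x
        + (christoffelMat g k x * christoffelMat g l x
          - christoffelMat g l x * christoffelMat g k x) := by
    ext i j
    simp [riemannUp, pdMat, christoffelMat, Matrix.mul_apply, Finset.sum_sub_distrib]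
  have hΓ : ∀ i, pdMat i E x = E x * christoffelMat g i x - connForm ω (E x) i * E x :=
    fun i => by rw [hg, h.mul_christoffelMat hκ]; abel
  -- Differentiate `E Γ_l = ∂_l E + Ω_l E`.
  have hdiff : ∀ k l, E x * pdMat k (christoffelMat g l) x
      = pdMat k (pdMat l E) x + pdMat k (fun y => connForm ω (E y) l) x * E x
        + connForm ω (E x) l * pdMat k E x - pdMat k E x * christoffelMat g l x := by
    intro k l
    have e1 := pdMat_mul h.diff (h.diff_christoffelMat hκ l) k x
    have e2 : (fun y => E y * christoffelMat (fun y => κ • ((E y)ᵀ * E y)) l y)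
        = fun y => pdMat l E y + connForm ω (E y) l * E y :=
      funext fun y => h.mul_christoffelMat hκ l y
    rw [e2, pdMat_add (h.diff_pdMat l) ((h.diff_connForm l).mul h.diff),
      pdMat_mul (h.diff_connForm l) h.diff] at e1
    rw [eq_sub_iff_add_eq, add_comm, ← e1]
    abel
  have hcomm : connForm ω (E x) k * connForm ω (E x) l - connForm ω (E x) l * connForm ω (E x) k
      = ∑ c, ∑ d, (E x c k * E x d l) • (ω c * ω d - ω d * ω c) := by
    simp only [connForm, Finset.sum_mul_sum, smul_sub, Finset.sum_sub_distrib, smul_mul_smul_comm]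
    congr 1
    rw [Finset.sum_comm]
    exact Finset.sum_congr rfl fun c _ => Finset.sum_congr rfl fun d _ => by rw [mul_comm]
  have hcurv : ∑ c, ∑ d, (E x c k * E x d l) • frameCurv ω c d
      = pdMat k (fun y => connForm ω (E y) l) x - pdMat l (fun y => connForm ω (E y) k) x
        + (connForm ω (E x) k * connForm ω (E x) l
          - connForm ω (E x) l * connForm ω (E x) k) := by
    rw [h.pdMat_connForm_sub, hcomm]
    simp only [frameCurv, smul_sub, Finset.sum_sub_distrib]
    abel
  rw [hR, hcurv, Matrix.mul_add, Matrix.mul_sub, hdiff, hdiff, h.pdMat_comm l k, hΓ k, hΓ l]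
  noncomm_ring

lemma riemannUp_eq (h : IsInvariantCoframe E F ω) (hκ : κ ≠ 0) (x : ι → ℝ) (i j k l : ι) :
    riemannUp (fun y => κ • ((E y)ᵀ * E y)) x i j k l
      = ∑ a, ∑ b, ∑ c, ∑ d, F x i a * E x b j * E x c k * E x d l * frameCurv ω c d a b := by
  have e : Matrix.of (fun i j => riemannUp (fun y => κ • ((E y)ᵀ * E y)) x i j k l)
      = F x * ((∑ c, ∑ d, (E x c k * E x d l) • frameCurv ω c d) * E x) := by
    rw [← h.mul_riemannUp hκ, ← Matrix.mul_assoc, h.inv_mul, Matrix.one_mul]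
  have := congrFun (congrFun e i) j
  simp only [Matrix.of_apply] at this
  rw [this, Matrix.mul_apply]
  simp only [Matrix.mul_apply, Matrix.sum_apply, Matrix.smul_apply, smul_eq_mul, Finset.sum_mul,
    Finset.mul_sum]
  refine Finset.sum_congr rfl fun a _ => Finset.sum_congr rfl fun b _ =>
    Finset.sum_congr rfl fun c _ => Finset.sum_congr rfl fun d _ => by ring

lemma ricci_eq (h : IsInvariantCoframe E F ω) (hκ : κ ≠ 0) (x : ι → ℝ) :
    ricci (fun y => κ • ((E y)ᵀ * E y)) x = (E x)ᵀ * frameRicci ω * E x := by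
  ext j l
  have hEF : ∀ c a, ∑ i, F x i a * E x c i = (1 : Matrix ι ι ℝ) c a := by
    intro c a
    rw [← h.mul_inv x, Matrix.mul_apply]
    exact Finset.sum_congr rfl fun i _ => mul_comm _ _
  have e : ∀ i, riemannUp (fun y => κ • ((E y)ᵀ * E y)) x i j i l
      = ∑ a, ∑ b, ∑ c, ∑ d, (F x i a * E x c i) * (E x b j * E x d l * frameCurv ω c d a b) := by
    intro i
    rw [h.riemannUp_eq hκ]
    exact Finset.sum_congr rfl fun a _ => Finset.sum_congr rfl fun b _ =>
      Finset.sum_congr rfl fun c _ => Finset.sum_congr rfl fun d _ => by ring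
  simp only [ricci, Matrix.of_apply, e]
  rw [Finset.sum_comm]
  have e2 : ∀ a, ∑ i, ∑ b, ∑ c, ∑ d, (F x i a * E x c i)
        * (E x b j * E x d l * frameCurv ω c d a b)
      = ∑ b, ∑ d, E x b j * E x d l * frameCurv ω a d a b := by
    intro a
    rw [Finset.sum_comm]
    refine Finset.sum_congr rfl fun b _ => ?_
    rw [Finset.sum_comm]
    simp only [← Finset.mul_sum]
    simp only [← Finset.sum_mul, hEF, Matrix.one_apply, ite_mul, one_mul, zero_mul,
      Finset.sum_ite_eq', Finset.mem_univ, if_true]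
  simp only [e2, Matrix.mul_apply, frameRicci, Matrix.of_apply, Matrix.transpose_apply,
    Finset.sum_mul, Finset.mul_sum]
  rw [Finset.sum_comm]
  conv_rhs => rw [Finset.sum_comm]
  refine Finset.sum_congr rfl fun b _ => ?_
  rw [Finset.sum_comm]
  exact Finset.sum_congr rfl fun d _ => Finset.sum_congr rfl fun a _ => by ring

end IsInvariantCoframe

/-! ### Scalar invariants of invariant metrics -/

lemma frameBox_sub_smul_one (ω : ι → Matrix ι ι ℝ) (t : Matrix ι ι ℝ) (a : ℝ) :
    frameBox ω (t - a • (1 : Matrix ι ι ℝ)) = frameBox ω t := by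
  have : ∀ c, frameCov ω (t - a • (1 : Matrix ι ι ℝ)) c = frameCov ω t c := by
    intro c
    simp only [frameCov, Matrix.mul_sub, Matrix.sub_mul, Matrix.mul_smul, Matrix.smul_mul,
      Matrix.mul_one, Matrix.one_mul]
    abel
  simp only [frameBox, this]

namespace IsInvariantCoframe

variable {E F : (ι → ℝ) → Matrix ι ι ℝ} {ω : ι → Matrix ι ι ℝ} {κ : ℝ}

lemma transpose_inv_mul (h : IsInvariantCoframe E F ω) (x : ι → ℝ) : (F x)ᵀ * (E x)ᵀ = 1 := by
  rw [← Matrix.transpose_mul, h.mul_inv, Matrix.transpose_one]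

lemma ricciUp_eq (h : IsInvariantCoframe E F ω) (hκ : κ ≠ 0) (x : ι → ℝ) :
    ricciUp (fun y => κ • ((E y)ᵀ * E y)) x
      = (κ⁻¹ ^ 2) • (F x * frameRicci ω * (F x)ᵀ) := by
  rw [ricciUp, h.ricci_eq hκ, h.metric_inv hκ]
  simp only [Matrix.smul_mul, Matrix.mul_smul, smul_smul, pow_two]
  congr 1
  calc F x * (F x)ᵀ * ((E x)ᵀ * frameRicci ω * E x) * (F x * (F x)ᵀ)
      = F x * ((F x)ᵀ * (E x)ᵀ) * frameRicci ω * (E x * F x) * (F x)ᵀ := by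
        simp only [Matrix.mul_assoc]
    _ = _ := by rw [h.transpose_inv_mul, h.mul_inv, Matrix.mul_one, Matrix.mul_one]

lemma scalarCurv_eq (h : IsInvariantCoframe E F ω) (hκ : κ ≠ 0) (x : ι → ℝ) :
    scalarCurv (fun y => κ • ((E y)ᵀ * E y)) x = κ⁻¹ * (frameRicci ω).trace := by
  have e : scalarCurv (fun y => κ • ((E y)ᵀ * E y)) x
      = ((κ⁻¹ • (F x * (F x)ᵀ))ᵀ * ((E x)ᵀ * frameRicci ω * E x)).trace := by
    simp only [scalarCurv, h.ricci_eq hκ, h.metric_inv hκ]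
    rw [Finset.sum_comm]
    simp only [Matrix.trace, Matrix.diag_apply, Matrix.mul_apply (M := (_ : Matrix ι ι ℝ)ᵀ),
      Matrix.transpose_apply]
  rw [e, Matrix.transpose_smul, Matrix.transpose_mul, Matrix.transpose_transpose,
    Matrix.smul_mul, Matrix.trace_smul, smul_eq_mul]
  congr 1
  calc (F x * (F x)ᵀ * ((E x)ᵀ * frameRicci ω * E x)).trace
      = (F x * (((F x)ᵀ * (E x)ᵀ) * frameRicci ω * E x)).trace := by
        simp only [Matrix.mul_assoc]
    _ = _ := by
        rw [h.transpose_inv_mul, Matrix.one_mul, Matrix.trace_mul_comm, Matrix.mul_assoc,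
          h.mul_inv, Matrix.mul_one]

lemma ricciSq_eq (h : IsInvariantCoframe E F ω) (hκ : κ ≠ 0) (x : ι → ℝ) :
    ricciSq (fun y => κ • ((E y)ᵀ * E y)) x
      = κ⁻¹ ^ 2 * ((frameRicci ω)ᵀ * frameRicci ω).trace := by
  have e : ricciSq (fun y => κ • ((E y)ᵀ * E y)) x
      = (((E x)ᵀ * frameRicci ω * E x)ᵀ
          * ((κ⁻¹ ^ 2) • (F x * frameRicci ω * (F x)ᵀ))).trace := by
    simp only [ricciSq, h.ricci_eq hκ, h.ricciUp_eq hκ]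
    rw [Finset.sum_comm]
    simp only [Matrix.trace, Matrix.diag_apply, Matrix.mul_apply (M := (_ : Matrix ι ι ℝ)ᵀ),
      Matrix.transpose_apply]
  rw [e, Matrix.mul_smul, Matrix.trace_smul, smul_eq_mul]
  congr 1
  rw [Matrix.transpose_mul, Matrix.transpose_mul, Matrix.transpose_transpose]
  calc ((E x)ᵀ * ((frameRicci ω)ᵀ * E x) * (F x * frameRicci ω * (F x)ᵀ)).trace
      = ((E x)ᵀ * ((frameRicci ω)ᵀ * (E x * F x) * frameRicci ω * (F x)ᵀ)).trace := by
        simp only [Matrix.mul_assoc]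
    _ = _ := by
        rw [h.mul_inv, Matrix.mul_one, Matrix.trace_mul_comm, Matrix.mul_assoc,
          h.transpose_inv_mul, Matrix.mul_one]

/-! ### Covariant derivatives of invariant tensors -/

lemma diff_tensor (h : IsInvariantCoframe E F ω) (t : Matrix ι ι ℝ) :
    EntrywiseDifferentiable fun y => (E y)ᵀ * t * E y :=
  (h.diff.transpose.mul (.const t)).mul h.diff

lemma pdMat_tensor_sub (h : IsInvariantCoframe E F ω) (hκ : κ ≠ 0) (t : Matrix ι ι ℝ) (k : ι)
    (x : ι → ℝ) :
    pdMat k (fun y => (E y)ᵀ * t * E y) x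
      - ((christoffelMat (fun y => κ • ((E y)ᵀ * E y)) k x)ᵀ * ((E x)ᵀ * t * E x)
        + (E x)ᵀ * t * E x * christoffelMat (fun y => κ • ((E y)ᵀ * E y)) k x)
      = ∑ c, E x c k • ((E x)ᵀ * frameCov ω t c * E x) := by
  set Γ := christoffelMat (fun y => κ • ((E y)ᵀ * E y)) k x with hΓdef
  have hΓ : pdMat k E x = E x * Γ - connForm ω (E x) k * E x := by
    rw [hΓdef, h.mul_christoffelMat hκ]; abel
  have e1 : pdMat k (fun y => (E y)ᵀ * t * E y) x
      = (pdMat k E x)ᵀ * t * E x + (E x)ᵀ * t * pdMat k E x := by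
    rw [pdMat_mul (h.diff.transpose.mul (.const t)) h.diff,
      pdMat_mul h.diff.transpose (.const t), pdMat_transpose, pdMat_const, Matrix.mul_zero,
      add_zero]
  have e2 : ∑ c, E x c k • ((E x)ᵀ * frameCov ω t c * E x)
      = (E x)ᵀ * (connForm ω (E x) k * t - t * connForm ω (E x) k) * E x := by
    simp only [connForm, frameCov, Finset.sum_mul, Finset.mul_sum, Matrix.mul_sub, Matrix.sub_mul,
      Matrix.smul_mul, Matrix.mul_smul, Finset.sum_sub_distrib, smul_sub]
  rw [e1, e2, hΓ, Matrix.transpose_sub, Matrix.transpose_mul, Matrix.transpose_mul,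
    h.connForm_transpose]
  noncomm_ring

lemma covDeriv_eq (h : IsInvariantCoframe E F ω) (hκ : κ ≠ 0) (t : Matrix ι ι ℝ) (x : ι → ℝ)
    (k i j : ι) :
    covDeriv (fun y => κ • ((E y)ᵀ * E y)) (fun y => (E y)ᵀ * t * E y) x k i j
      = ∑ c, E x c k * ((E x)ᵀ * frameCov ω t c * E x) i j := by
  have := congrFun (congrFun (h.pdMat_tensor_sub hκ t k x) i) j
  simp only [Matrix.sum_apply, Matrix.smul_apply, smul_eq_mul] at this
  rw [← this]
  simp only [covDeriv, Finset.sum_add_distrib]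
  simp only [Matrix.sub_apply, Matrix.add_apply]
  congr 1
  congr 1
  rw [Matrix.mul_apply]
  exact Finset.sum_congr rfl fun p _ => mul_comm _ _

lemma covDeriv₂_eq (h : IsInvariantCoframe E F ω) (hκ : κ ≠ 0) (t : Matrix ι ι ℝ) (x : ι → ℝ)
    (l k i j : ι) :
    covDeriv₂ (fun y => κ • ((E y)ᵀ * E y)) (fun y => (E y)ᵀ * t * E y) x l k i j
      = ∑ c, ∑ d, (E x d l * E x c k) * ((E x)ᵀ *
          (frameCov ω (frameCov ω t c) d - ∑ p, ω d p c • frameCov ω t p) * E x) i j := by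
  set g : (ι → ℝ) → Matrix ι ι ℝ := fun y => κ • ((E y)ᵀ * E y) with hg
  set W : ι → (ι → ℝ) → Matrix ι ι ℝ := fun c y => (E y)ᵀ * frameCov ω t c * E y with hW
  have hcov : ∀ y k i j, covDeriv g (fun y => (E y)ᵀ * t * E y) y k i j
      = ∑ c, E y c k * W c y i j := fun y k i j => h.covDeriv_eq hκ t y k i j
  have hWcov : ∀ c, pd l (fun y => W c y i j) x
      = ∑ d, E x d l * ((E x)ᵀ * frameCov ω (frameCov ω t c) d * E x) i j
        + ∑ p, (christoffel g x p l i * W c x p j + christoffel g x p l j * W c x i p) := by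
    intro c
    rw [← h.covDeriv_eq hκ (frameCov ω t c) x l i j]
    simp only [covDeriv, hg, hW]
    ring
  have hΓ : ∀ c, pd l (fun y => E y c k) x
      = ∑ p, E x c p * christoffel g x p l k - ∑ p, ∑ d, (E x d l * E x p k) * ω d c p := by
    intro c
    have := congrFun (congrFun (h.mul_christoffelMat hκ l x) c) k
    rw [Matrix.mul_apply, Matrix.add_apply, Matrix.mul_apply] at this
    simp only [connForm, Matrix.sum_apply, Matrix.smul_apply, smul_eq_mul, Finset.sum_mul] at this
    have e : ∑ p, ∑ d, (E x d l * E x p k) * ω d c p = ∑ p, ∑ d, E x d l * ω d c p * E x p k :=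
      Finset.sum_congr rfl fun p _ => Finset.sum_congr rfl fun d _ => by ring
    rw [e]
    exact eq_sub_of_add_eq this.symm
  have hd : ∀ c ∈ Finset.univ, DifferentiableAt ℝ (fun y => E y c k * W c y i j) x :=
    fun c _ => (h.diff c k x).mul (h.diff_tensor _ i j x)
  have hpd : ∀ c, pd l (fun y => E y c k * W c y i j) x
      = pd l (fun y => E y c k) x * W c x i j + E x c k * pd l (fun y => W c y i j) x :=
    fun c => pd_mul (h.diff c k x) (h.diff_tensor _ i j x)
  simp only [covDeriv₂, hcov]
  rw [pd_sum hd]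
  simp only [hpd, hWcov, hΓ]
  -- The Christoffel terms cancel against those of `∇∇T`; the frame expression remains.
  have r1 : ∑ p, christoffel g x p l k * ∑ c, E x c p * W c x i j
      = ∑ c, (∑ p, E x c p * christoffel g x p l k) * W c x i j := by
    simp only [Finset.mul_sum, Finset.sum_mul]
    rw [Finset.sum_comm]
    exact Finset.sum_congr rfl fun c _ => Finset.sum_congr rfl fun p _ => by ring
  have r2 : ∑ p, (christoffel g x p l i * ∑ c, E x c k * W c x p j)
        + ∑ p, (christoffel g x p l j * ∑ c, E x c k * W c x i p)
      = ∑ c, E x c k * ∑ p, (christoffel g x p l i * W c x p j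
          + christoffel g x p l j * W c x i p) := by
    simp only [Finset.mul_sum, ← Finset.sum_add_distrib]
    rw [Finset.sum_comm]
    exact Finset.sum_congr rfl fun c _ => Finset.sum_congr rfl fun p _ => by ring
  have r3 : ∑ c, ∑ d, (E x d l * E x c k) * ((E x)ᵀ *
          (frameCov ω (frameCov ω t c) d - ∑ p, ω d p c • frameCov ω t p) * E x) i j
      = ∑ c, E x c k * ∑ d, E x d l * ((E x)ᵀ * frameCov ω (frameCov ω t c) d * E x) i j
        - ∑ c, (∑ p, ∑ d, (E x d l * E x p k) * ω d c p) * W c x i j := by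
    have s1 : ∀ c d, ((E x)ᵀ * (frameCov ω (frameCov ω t c) d
          - ∑ p, ω d p c • frameCov ω t p) * E x) i j
        = ((E x)ᵀ * frameCov ω (frameCov ω t c) d * E x) i j - ∑ p, ω d p c * W p x i j := by
      intro c d
      simp only [Matrix.mul_sub, Matrix.sub_mul, Finset.mul_sum, Finset.sum_mul, Matrix.mul_smul,
        Matrix.smul_mul, Matrix.sub_apply, Matrix.sum_apply, Matrix.smul_apply, smul_eq_mul, hW]
    simp only [s1]
    simp only [mul_sub, Finset.sum_sub_distrib, Finset.mul_sum, Finset.sum_mul]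
    congr 1
    · exact Finset.sum_congr rfl fun c _ => Finset.sum_congr rfl fun d _ => by ring
    · rw [Finset.sum_comm_cycle]
      exact Finset.sum_congr rfl fun c _ => Finset.sum_congr rfl fun d _ =>
        Finset.sum_congr rfl fun p _ => by ring
  rw [r3]
  simp only [sub_mul, mul_add, Finset.sum_add_distrib, Finset.sum_sub_distrib] at r2 ⊢
  linarith

lemma boxTensor_eq (h : IsInvariantCoframe E F ω) (hκ : κ ≠ 0) (t : Matrix ι ι ℝ) (x : ι → ℝ)
    (i j : ι) :
    boxTensor (fun y => κ • ((E y)ᵀ * E y)) (fun y => (E y)ᵀ * t * E y) x i j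
      = κ⁻¹ * ((E x)ᵀ * frameBox ω t * E x) i j := by
  set G : ι → ι → ℝ := fun c d => ((E x)ᵀ *
          (frameCov ω (frameCov ω t c) d - ∑ p, ω d p c • frameCov ω t p) * E x) i j with hG
  have e : ∀ l k, covDeriv₂ (fun y => κ • ((E y)ᵀ * E y)) (fun y => (E y)ᵀ * t * E y) x l k i j
      = ∑ c, ∑ d, (E x d l * E x c k) * G c d := fun l k => h.covDeriv₂_eq hκ t x l k i j
  have hδ : ∀ c d, ∑ l, ∑ k, (F x * (F x)ᵀ) l k * (E x d l * E x c k)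
      = if d = c then 1 else 0 := by
    intro c d
    have : E x * (F x * (F x)ᵀ) * (E x)ᵀ = 1 := by
      rw [← Matrix.mul_assoc, h.mul_inv, Matrix.one_mul, h.transpose_inv_mul]
    rw [← Matrix.one_apply, ← this]
    rw [Matrix.mul_apply, Finset.sum_comm]
    simp only [Matrix.mul_apply (M := E x), Finset.sum_mul, Matrix.transpose_apply (M := E x)]
    exact Finset.sum_congr rfl fun k _ => Finset.sum_congr rfl fun l _ => by ring
  have e2 : ((E x)ᵀ * frameBox ω t * E x) i j = ∑ c, G c c := by
    simp only [frameBox, Finset.mul_sum, Finset.sum_mul, Matrix.sum_apply, hG]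
  simp only [boxTensor, h.metric_inv hκ, e, Matrix.smul_apply, smul_eq_mul, e2]
  calc ∑ l, ∑ k, κ⁻¹ * (F x * (F x)ᵀ) l k * ∑ c, ∑ d, (E x d l * E x c k) * G c d
      = κ⁻¹ * ∑ c, ∑ d, (∑ l, ∑ k, (F x * (F x)ᵀ) l k * (E x d l * E x c k)) * G c d := by
        simp only [Finset.mul_sum, Finset.sum_mul]
        rw [Finset.sum_comm_cycle]
        refine Finset.sum_congr rfl fun c _ => ?_
        rw [Finset.sum_comm_cycle]
        refine Finset.sum_congr rfl fun d _ => Finset.sum_congr rfl fun l _ =>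
          Finset.sum_congr rfl fun k _ => by ring
    _ = _ := by simp [hδ]

/-- The term `R_{μσνρ} R^{σρ}` for an invariant metric. -/
lemma sum_riemann_mul_ricciUp (h : IsInvariantCoframe E F ω) (hκ : κ ≠ 0) (x : ι → ℝ) (μ ν : ι) :
    ∑ σ, ∑ ρ, riemann (fun y => κ • ((E y)ᵀ * E y)) x μ σ ν ρ
        * ricciUp (fun y => κ • ((E y)ᵀ * E y)) x σ ρ
      = κ⁻¹ * ((E x)ᵀ * frameCurvAct ω (frameRicci ω) * E x) μ ν := by
  have hE : (E x)ᵀ * E x * F x = (E x)ᵀ := by rw [Matrix.mul_assoc, h.mul_inv, Matrix.mul_one]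
  have e : ∀ σ ρ, riemann (fun y => κ • ((E y)ᵀ * E y)) x μ σ ν ρ
      = κ * ∑ a, ∑ b, ∑ c, ∑ d, E x a μ * E x b σ * E x c ν * E x d ρ * frameCurv ω c d a b := by
    intro σ ρ
    have ha : ∀ a, E x a μ = ∑ p, ((E x)ᵀ * E x) μ p * F x p a := by
      intro a
      rw [← Matrix.mul_apply, hE, Matrix.transpose_apply]
    simp only [riemann, h.riemannUp_eq hκ, Matrix.smul_apply, smul_eq_mul, mul_assoc κ,
      ← Finset.mul_sum]
    congr 1
    simp only [ha, Finset.mul_sum, Finset.sum_mul]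
    rw [Finset.sum_comm]
    refine Finset.sum_congr rfl fun a _ => ?_
    rw [Finset.sum_comm]
    refine Finset.sum_congr rfl fun b _ => ?_
    rw [Finset.sum_comm]
    refine Finset.sum_congr rfl fun c _ => ?_
    rw [Finset.sum_comm]
    exact Finset.sum_congr rfl fun d _ => Finset.sum_congr rfl fun p _ => by ring
  have hδ : ∀ b d, ∑ σ, ∑ ρ, (E x b σ * E x d ρ) * (F x * frameRicci ω * (F x)ᵀ) σ ρ
      = frameRicci ω b d := by
    intro b d
    have : E x * (F x * frameRicci ω * (F x)ᵀ) * (E x)ᵀ = frameRicci ω := by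
      rw [← Matrix.mul_assoc, ← Matrix.mul_assoc, h.mul_inv, Matrix.one_mul, Matrix.mul_assoc,
        h.transpose_inv_mul, Matrix.mul_one]
    conv_rhs => rw [← this]
    rw [Matrix.mul_apply, Finset.sum_comm]
    simp only [Matrix.mul_apply (M := E x), Finset.sum_mul, Matrix.transpose_apply (M := E x)]
    exact Finset.sum_congr rfl fun k _ => Finset.sum_congr rfl fun l _ => by ring
  simp only [e, h.ricciUp_eq hκ, Matrix.smul_apply, smul_eq_mul]
  set P := F x * frameRicci ω * (F x)ᵀ with hP
  calc ∑ σ, ∑ ρ, κ * (∑ a, ∑ b, ∑ c, ∑ d,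
          E x a μ * E x b σ * E x c ν * E x d ρ * frameCurv ω c d a b) * (κ⁻¹ ^ 2 * P σ ρ)
      = κ⁻¹ * ∑ σ, ∑ ρ, ∑ a, ∑ b, ∑ c, ∑ d,
          E x a μ * E x c ν * frameCurv ω c d a b * ((E x b σ * E x d ρ) * P σ ρ) := by
        simp only [Finset.mul_sum, Finset.sum_mul]
        refine Finset.sum_congr rfl fun σ _ => Finset.sum_congr rfl fun ρ _ =>
          Finset.sum_congr rfl fun a _ => Finset.sum_congr rfl fun b _ =>
          Finset.sum_congr rfl fun c _ => Finset.sum_congr rfl fun d _ => ?_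
        field_simp
    _ = κ⁻¹ * ∑ a, ∑ b, ∑ c, ∑ d, E x a μ * E x c ν * frameCurv ω c d a b
          * ∑ σ, ∑ ρ, (E x b σ * E x d ρ) * P σ ρ := by
        congr 1
        simp only [Finset.mul_sum]
        rw [Finset.sum_comm_cycle]
        refine Finset.sum_congr rfl fun a _ => ?_
        rw [Finset.sum_comm_cycle]
        refine Finset.sum_congr rfl fun b _ => ?_
        rw [Finset.sum_comm_cycle]
        refine Finset.sum_congr rfl fun c _ => ?_
        rw [Finset.sum_comm_cycle]
    _ = _ := by
        simp only [hδ, Matrix.mul_apply, frameCurvAct, Matrix.of_apply, Matrix.transpose_apply,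
          Finset.sum_mul, Finset.mul_sum]
        conv_rhs => rw [Finset.sum_comm]
        refine Finset.sum_congr rfl fun a _ => ?_
        rw [Finset.sum_comm]
        exact Finset.sum_congr rfl fun c _ => Finset.sum_congr rfl fun b _ =>
          Finset.sum_congr rfl fun d _ => by ring

/-- The tensor `Φ` of an invariant metric is the invariant tensor with the displayed constant
frame components: the scalar curvature is constant, so its derivatives drop out. -/
lemma Phi_eq (h : IsInvariantCoframe E F ω) (hκ : κ ≠ 0) (α β : ℝ) (x : ι → ℝ) (μ ν : ι) :
    Phi α β (fun y => κ • ((E y)ᵀ * E y)) x μ ν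
      = ((E x)ᵀ * (frameRicci ω - (1 / 2 * (frameRicci ω).trace) • (1 : Matrix ι ι ℝ)
          + (2 * α * κ⁻¹ * (frameRicci ω).trace) •
            (frameRicci ω - (1 / 4 * (frameRicci ω).trace) • (1 : Matrix ι ι ℝ))
          + (β * κ⁻¹) • frameBox ω (frameRicci ω)
          + (2 * β * κ⁻¹) • (frameCurvAct ω (frameRicci ω)
            - (1 / 4 * ((frameRicci ω)ᵀ * frameRicci ω).trace) • (1 : Matrix ι ι ℝ))) * E x) μ ν := by
  set g : (ι → ℝ) → Matrix ι ι ℝ := fun y => κ • ((E y)ᵀ * E y) with hg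
  set s := (frameRicci ω).trace with hs
  have hR : scalarCurv g = fun _ => κ⁻¹ * s := funext fun y => h.scalarCurv_eq hκ y
  have hH : ∀ i j, hessian g (fun _ => κ⁻¹ * s) x i j = 0 := by
    intro i j
    simp [hessian, pd_const]
  have hT : (fun y => ricci g y - ((1 / 2) * (κ⁻¹ * s)) • g y)
      = fun y => (E y)ᵀ * (frameRicci ω - (1 / 2 * s) • (1 : Matrix ι ι ℝ)) * E y := by
    funext y
    rw [hg, h.ricci_eq hκ]
    simp only [smul_smul, Matrix.mul_sub, Matrix.sub_mul, Matrix.mul_smul, Matrix.smul_mul,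
      Matrix.mul_one]
    congr 2
    field_simp
  have hsq : ∑ σ, ∑ ρ, ricci g x σ ρ * ricciUp g x σ ρ
      = κ⁻¹ ^ 2 * ((frameRicci ω)ᵀ * frameRicci ω).trace := h.ricciSq_eq hκ x
  have hlast : ∑ σ, ∑ ρ, (riemann g x μ σ ν ρ - (1 / 4) * g x μ ν * ricci g x σ ρ)
        * ricciUp g x σ ρ
      = κ⁻¹ * ((E x)ᵀ * frameCurvAct ω (frameRicci ω) * E x) μ ν
        - (1 / 4) * g x μ ν * (κ⁻¹ ^ 2 * ((frameRicci ω)ᵀ * frameRicci ω).trace) := by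
    rw [← h.sum_riemann_mul_ricciUp hκ, ← hsq]
    simp only [sub_mul, Finset.sum_sub_distrib, Finset.mul_sum, mul_assoc, hg]
  have hgx : g x μ ν = κ * ((E x)ᵀ * E x) μ ν := rfl
  have hric : ricci g x μ ν = ((E x)ᵀ * frameRicci ω * E x) μ ν := by rw [hg, h.ricci_eq hκ]
  simp only [Phi, hR, boxFun, hH, hT, hlast]
  rw [hg, h.boxTensor_eq hκ, ← hg, frameBox_sub_smul_one, hric, hgx]
  simp only [Matrix.mul_add, Matrix.add_mul, Matrix.mul_sub, Matrix.sub_mul, Matrix.mul_smul,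
      Matrix.smul_mul, Matrix.mul_one, smul_sub, smul_smul, Matrix.add_apply, Matrix.sub_apply,
      Matrix.smul_apply, smul_eq_mul, mul_zero, Finset.sum_const_zero]
  field_simp
  ring

end IsInvariantCoframe

/-! ### Solvable extensions of invariant coframes -/

lemma pd_comp_inr (i : ι) {f : (ι → ℝ) → ℝ} (hf : Differentiable ℝ f) (x : Unit ⊕ ι → ℝ) :
    pd (Sum.inr i) (fun y => f (y ∘ Sum.inr)) x = pd i f (x ∘ Sum.inr) := by
  let L : (Unit ⊕ ι → ℝ) →L[ℝ] (ι → ℝ) :=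
    ContinuousLinearMap.pi fun a => ContinuousLinearMap.proj (Sum.inr a)
  have hL : (fun y : Unit ⊕ ι → ℝ => f (y ∘ Sum.inr)) = f ∘ L := rfl
  have hs : L (Pi.single (Sum.inr i) 1) = Pi.single i 1 := by
    ext a; simp [L, Pi.single_apply]
  rw [pd, hL, fderiv_comp x (hf _) L.differentiableAt, ContinuousLinearMap.fderiv,
    ContinuousLinearMap.comp_apply, hs]
  rfl

lemma pd_comp_inr_inl (u : Unit) {f : (ι → ℝ) → ℝ} (hf : Differentiable ℝ f)
    (x : Unit ⊕ ι → ℝ) : pd (Sum.inl u) (fun y => f (y ∘ Sum.inr)) x = 0 := by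
  let L : (Unit ⊕ ι → ℝ) →L[ℝ] (ι → ℝ) :=
    ContinuousLinearMap.pi fun a => ContinuousLinearMap.proj (Sum.inr a)
  have hL : (fun y : Unit ⊕ ι → ℝ => f (y ∘ Sum.inr)) = f ∘ L := rfl
  have hs : L (Pi.single (Sum.inl u) 1) = 0 := by
    ext a; simp [L]
  rw [pd, hL, fderiv_comp x (hf _) L.differentiableAt, ContinuousLinearMap.fderiv,
    ContinuousLinearMap.comp_apply, hs, map_zero]

/-- The coframe `ds, e^{-d_a s} θ^a` on `ℝ × ℝ^ι`, for weights `d` and a coframe `θ` on `ℝ^ι`. -/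
def extCoframe (d : ι → ℝ) (E : (ι → ℝ) → Matrix ι ι ℝ) (y : Unit ⊕ ι → ℝ) :
    Matrix (Unit ⊕ ι) (Unit ⊕ ι) ℝ :=
  Matrix.fromBlocks 1 0 0
    (Matrix.of fun a i => Real.exp (-d a * y (Sum.inl ())) * E (y ∘ Sum.inr) a i)

/-- The inverse matrix of `extCoframe d E`, where `F` is the inverse of `E`. -/
def extCoframeInv (d : ι → ℝ) (F : (ι → ℝ) → Matrix ι ι ℝ) (y : Unit ⊕ ι → ℝ) :
    Matrix (Unit ⊕ ι) (Unit ⊕ ι) ℝ :=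
  Matrix.fromBlocks 1 0 0
    (Matrix.of fun i a => F (y ∘ Sum.inr) i a * Real.exp (d a * y (Sum.inl ())))

/-- The connection coefficients of `extCoframe`: those of `ω`, together with the second
fundamental form `diag d` of the slices `s = const`. -/
def extConn (d : ι → ℝ) (ω : ι → Matrix ι ι ℝ) :
    Unit ⊕ ι → Matrix (Unit ⊕ ι) (Unit ⊕ ι) ℝ :=
  Sum.elim (fun _ => 0) fun b =>
    Matrix.fromBlocks 0 (Matrix.of fun _ c => if c = b then d b else 0)
      (Matrix.of fun c _ => -(if c = b then d b else 0)) (ω b)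

section

variable (d : ι → ℝ) (E F : (ι → ℝ) → Matrix ι ι ℝ) (ω : ι → Matrix ι ι ℝ) (y : Unit ⊕ ι → ℝ)
  (u v : Unit) (a b c : ι)

@[simp] lemma extCoframe_ll : extCoframe d E y (.inl u) (.inl v) = 1 := rfl
@[simp] lemma extCoframe_lr : extCoframe d E y (.inl u) (.inr a) = 0 := rfl
@[simp] lemma extCoframe_rl : extCoframe d E y (.inr a) (.inl u) = 0 := rfl
@[simp] lemma extCoframe_rr : extCoframe d E y (.inr a) (.inr b)
    = Real.exp (-d a * y (Sum.inl ())) * E (y ∘ Sum.inr) a b := rfl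
@[simp] lemma extConn_l : extConn d ω (.inl u) = 0 := rfl
@[simp] lemma extConn_r_ll : extConn d ω (.inr b) (.inl u) (.inl v) = 0 := rfl
@[simp] lemma extConn_r_lr :
    extConn d ω (.inr b) (.inl u) (.inr c) = if c = b then d b else 0 := rfl
@[simp] lemma extConn_r_rl :
    extConn d ω (.inr b) (.inr c) (.inl u) = -(if c = b then d b else 0) := rfl
@[simp] lemma extConn_r_rr : extConn d ω (.inr b) (.inr a) (.inr c) = ω b a c := rfl

end

lemma connForm_mul_apply (ω : ι → Matrix ι ι ℝ) (M : Matrix ι ι ℝ) (i a j : ι) :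
    (connForm ω M i * M) a j = ∑ b, ∑ c, M b i * ω b a c * M c j := by
  simp only [connForm, Matrix.mul_apply, Matrix.sum_apply, Matrix.smul_apply, smul_eq_mul,
    Finset.sum_mul]
  exact Finset.sum_comm

/-- The extended coframe of an invariant coframe is invariant, provided that `diag d` is a
derivation: `hd` says that `d_b + d_c = d_a` where the structure constant `c^a_{bc}` is nonzero. -/
theorem IsInvariantCoframe.ext {E F : (ι → ℝ) → Matrix ι ι ℝ} {ω : ι → Matrix ι ι ℝ}
    (h : IsInvariantCoframe E F ω) (d : ι → ℝ)
    (hd : ∀ a b c, ω b a c - ω c a b ≠ 0 → d b + d c = d a) :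
    IsInvariantCoframe (extCoframe d E) (extCoframeInv d F) (extConn d ω) where
  contDiff := by
    have hr : ContDiff ℝ 2 fun y : Unit ⊕ ι → ℝ => y ∘ Sum.inr :=
      contDiff_pi.2 fun i => contDiff_apply ℝ ℝ (Sum.inr i)
    have hl : ContDiff ℝ 2 fun y : Unit ⊕ ι → ℝ => y (Sum.inl ()) :=
      contDiff_apply ℝ ℝ (Sum.inl ())
    rintro (u | a) (v | i)
    · exact contDiff_const
    · exact contDiff_const
    · exact contDiff_const
    · exact ((contDiff_const.mul hl).exp).mul ((h.contDiff a i).comp hr)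
  diff_inv := by
    have hr : Differentiable ℝ fun y : Unit ⊕ ι → ℝ => y ∘ Sum.inr :=
      differentiable_pi.2 fun i => differentiable_apply (Sum.inr i)
    have hl : Differentiable ℝ fun y : Unit ⊕ ι → ℝ => y (Sum.inl ()) :=
      differentiable_apply (Sum.inl ())
    rintro (u | a) (v | i)
    · exact differentiable_const _
    · exact differentiable_const _
    · exact differentiable_const _
    · exact ((h.diff_inv a i).comp hr).mul ((hl.const_mul _).exp)
  inv_mul x := by
    have e : (Matrix.of fun i a => F (x ∘ Sum.inr) i a * Real.exp (d a * x (Sum.inl ())))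
        * (Matrix.of fun a i => Real.exp (-d a * x (Sum.inl ())) * E (x ∘ Sum.inr) a i)
        = F (x ∘ Sum.inr) * E (x ∘ Sum.inr) := by
      ext i j
      simp only [Matrix.mul_apply, Matrix.of_apply]
      refine Finset.sum_congr rfl fun a _ => ?_
      have : Real.exp (d a * x (Sum.inl ())) * Real.exp (-d a * x (Sum.inl ())) = 1 := by
        rw [← Real.exp_add, ← Real.exp_zero]; ring_nf
      linear_combination F (x ∘ Sum.inr) i a * E (x ∘ Sum.inr) a j * this
    rw [extCoframe, extCoframeInv, Matrix.fromBlocks_multiply, e, h.inv_mul]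
    simp
  skew := by
    rintro (u | b)
    · simp
    · ext (v | a) (w | c)
      · simp
      · simp
      · simp
      · exact congrFun (congrFun (h.skew b) a) c
  torsion := by
    intro x a i j
    have hEd : ∀ a i, Differentiable ℝ fun y => E y a i := fun a i => h.diff a i
    have hr : Differentiable ℝ fun y : Unit ⊕ ι → ℝ => y ∘ Sum.inr :=
      differentiable_pi.2 fun i => differentiable_apply (Sum.inr i)
    have hpd : ∀ k a i, pd k (fun y => extCoframe d E y (.inr a) (.inr i)) x
        = pd k (fun y => Real.exp (-d a * y (Sum.inl ()))) x * E (x ∘ Sum.inr) a i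
          + Real.exp (-d a * x (Sum.inl ())) * pd k (fun y => E (y ∘ Sum.inr) a i) x := by
      intro k a i
      exact pd_mul (by fun_prop) ((hEd a i).comp hr x)
    simp only [Matrix.add_apply, connForm_mul_apply, pdMat, Matrix.of_apply]
    rcases a with u | a
    · rcases i with v | i <;> rcases j with w | j <;>
        simp [Fintype.sum_sum_type, pd_const]
      exact Finset.sum_congr rfl fun b _ => by ring
    · rcases i with v | i <;> rcases j with w | j
      · rfl
      · rw [hpd, pd_exp, pd_comp_inr_inl _ (hEd a j)]
        simp [Fintype.sum_sum_type, pd_const]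
        ring
      · rw [hpd, pd_exp, pd_comp_inr_inl _ (hEd a i)]
        simp [Fintype.sum_sum_type, pd_const]
        ring
      · rw [hpd, hpd, pd_exp, pd_exp, pd_comp_inr _ (hEd a j), pd_comp_inr _ (hEd a i)]
        have ht := h.torsion (x ∘ Sum.inr) a i j
        simp only [Matrix.add_apply, connForm_mul_apply, pdMat, Matrix.of_apply] at ht
        set s := x (Sum.inl ())
        set M := E (x ∘ Sum.inr)
        -- By the derivation property the weights of a nonzero structure constant add up.
        have key : ∑ b, ∑ c, Real.exp (-d b * s) * M b i * ω b a c * (Real.exp (-d c * s) * M c j)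
              - ∑ b, ∑ c, Real.exp (-d b * s) * M b j * ω b a c * (Real.exp (-d c * s) * M c i)
            = Real.exp (-d a * s) * (∑ b, ∑ c, M b i * ω b a c * M c j
              - ∑ b, ∑ c, M b j * ω b a c * M c i) := by
          rw [Finset.sum_comm (f := fun b c =>
              Real.exp (-d b * s) * M b j * ω b a c * (Real.exp (-d c * s) * M c i)),
            Finset.sum_comm (f := fun b c => M b j * ω b a c * M c i)]
          simp only [← Finset.sum_sub_distrib, Finset.mul_sum]
          refine Finset.sum_congr rfl fun b _ => Finset.sum_congr rfl fun c _ => ?_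
          by_cases hz : ω b a c - ω c a b = 0
          · rw [sub_eq_zero.1 hz]; ring
          · have hw : Real.exp (-d b * s) * Real.exp (-d c * s) = Real.exp (-d a * s) := by
              rw [← Real.exp_add, ← hd a b c hz]; ring_nf
            rw [← hw]; ring
        simp only [Fintype.sum_sum_type, extConn_l, extConn_r_rr, extCoframe_rr, extCoframe_lr,
          Matrix.zero_apply, mul_zero, zero_mul, Finset.sum_const_zero, zero_add, reduceCtorEq,
          if_false]
        linear_combination Real.exp (-d a * s) * ht + key

/-- The Ricci tensor of the solvable extension of a frame whose fields have geodesic integral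
curves; `h0` says that `∇_{e_a} e_a = 0`. -/
theorem frameRicci_extConn {ω : ι → Matrix ι ι ℝ} (hs : ∀ b, (ω b)ᵀ = -ω b)
    (h0 : ∀ a p, ω a a p = 0) (d : ι → ℝ) :
    frameRicci (extConn d ω) = Matrix.fromBlocks ((-∑ a, d a ^ 2) • 1) 0 0
      (frameRicci ω - (∑ a, d a) • Matrix.diagonal d) := by
  have hd0 : ∀ a b, ω b a a = 0 := by
    intro a b
    have := congrFun (congrFun (hs b) a) a
    simp only [Matrix.transpose_apply, Matrix.neg_apply] at this
    linarith
  have e : ∀ {κ : Type} [Fintype κ] [DecidableEq κ] (ω : κ → Matrix κ κ ℝ) (b c : κ),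
      frameRicci ω b c = ∑ a, ∑ p, (ω a a p * ω c p b - ω c a p * ω a p b
        - (ω a p c - ω c p a) * ω p a b) := by
    intro κ _ _ ω b c
    simp only [frameRicci, frameCurv, Matrix.of_apply, Matrix.sub_apply, Matrix.mul_apply,
      Matrix.sum_apply, Matrix.smul_apply, smul_eq_mul, Finset.sum_sub_distrib]
  ext b c
  rw [e]
  rcases b with u | b <;> rcases c with v | c
  · simp [Fintype.sum_sum_type]
    exact Finset.sum_congr rfl fun a _ => by ring
  · simp [Fintype.sum_sum_type, h0, hd0]
  · simp [Fintype.sum_sum_type, h0]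
  · simp [Fintype.sum_sum_type, e, h0, Finset.sum_add_distrib, Matrix.diagonal_apply]
    split_ifs with hbc
    · subst hbc
      simp only [Finset.sum_mul]
      ring
    · simp

end ChartGeometry

end

noncomputable section

namespace GeneralisedHeisenberg

open Matrix ChartGeometry

variable {m n : ℕ} (H : GeneralisedHeisenberg m n)

/-! ### The frame tensors of a generalised Heisenberg algebra -/

lemma C_diag (k : Fin m) (i : Fin n) : H.C k i i = 0 := by
  linarith [H.skew k i i]

/-- The Clifford relations: polarisation of `J_ζ² = -|ζ|² id`. -/
lemma clifford (k l : Fin m) :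
    H.C k * H.C l + H.C l * H.C k = if k = l then (-2 : ℝ) • (1 : Matrix (Fin n) (Fin n) ℝ)
      else 0 := by
  have hT : ∀ k, (H.C k)ᵀ = -H.C k := by
    intro k; ext i j; exact H.skew k j i
  have single : ∀ k, H.C k * H.C k = -1 := by
    intro k
    have := H.J_sq (Pi.single k 1)
    simpa [Pi.single_apply, hT] using this
  split_ifs with hkl
  · subst hkl
    rw [single, neg_smul, two_smul]; abel
  · have := H.J_sq (Pi.single k 1 + Pi.single l 1)
    have hsq : ∀ p : Fin m, ((Pi.single k 1 + Pi.single l 1 : Fin m → ℝ) p) ^ 2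
        = (Pi.single k 1 : Fin m → ℝ) p + (Pi.single l 1 : Fin m → ℝ) p := by
      intro p
      simp only [Pi.add_apply, Pi.single_apply]
      split_ifs with h1 h2
      · exact absurd (h1.symm.trans h2) hkl
      all_goals norm_num
    simp only [hsq] at this
    simp only [Pi.add_apply, add_smul, Finset.sum_add_distrib, Pi.single_apply, ite_smul, one_smul,
      zero_smul, Finset.sum_ite_eq', Finset.mem_univ, if_true, hT, Matrix.add_mul, Matrix.mul_add, single, mul_neg, neg_mul, neg_neg] at this
    have h3 : H.C k * H.C l + H.C l * H.C k
        = (-(1 + -(H.C l * H.C k)) + -(-(H.C k * H.C l) + 1)) + ((1 : ℝ) + 1) • 1 := by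
      rw [add_smul, one_smul]; abel
    rw [h3, this, ← add_smul, neg_add_cancel, zero_smul]

lemma sum_C_mul_C (k : Fin m) (i j : Fin n) :
    ∑ p, H.C k i p * H.C k j p = if i = j then 1 else 0 := by
  have h := congrFun (congrFun (H.clifford k k) i) j
  simp only [if_true, Matrix.add_apply, Matrix.mul_apply, Matrix.smul_apply, Matrix.one_apply,
    smul_eq_mul] at h
  have : ∑ p, H.C k i p * H.C k j p = -∑ p, H.C k i p * H.C k p j := by
    rw [← Finset.sum_neg_distrib]
    exact Finset.sum_congr rfl fun p _ => by rw [H.skew k j p]; ring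
  rw [this]
  split_ifs at h ⊢ <;> linarith

lemma sum_sum_C_mul_C (k l : Fin m) :
    ∑ i, ∑ p, H.C k i p * H.C l i p = if k = l then (n : ℝ) else 0 := by
  have h := congrArg Matrix.trace (H.clifford k l)
  rw [Matrix.trace_add, Matrix.trace_mul_comm (H.C l)] at h
  have : ∑ i, ∑ p, H.C k i p * H.C l i p = -(H.C k * H.C l).trace := by
    simp only [Matrix.trace, Matrix.diag_apply, Matrix.mul_apply, ← Finset.sum_neg_distrib]
    exact Finset.sum_congr rfl fun i _ => Finset.sum_congr rfl fun p _ => by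
      rw [H.skew l i p]; ring
  rw [this]
  split_ifs at h ⊢
  · simp only [Matrix.trace_smul, Matrix.trace_one, Fintype.card_fin, smul_eq_mul] at h
    linarith
  · simp only [Matrix.trace_zero] at h
    linarith

/-- The Levi-Civita connection coefficients `conn b a c = ⟨∇_{e_b} e_c, e_a⟩` of the orthonormal
left-invariant frame, from the Koszul formula. -/
def conn : Fin n ⊕ Fin m → Matrix (Fin n ⊕ Fin m) (Fin n ⊕ Fin m) ℝ :=
  Sum.elim
    (fun j => Matrix.fromBlocks 0 (Matrix.of fun i k => 1 / 2 * H.C k i j)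
      (Matrix.of fun k i => -(1 / 2 * H.C k i j)) 0)
    (fun k => Matrix.fromBlocks ((1 / 2 : ℝ) • H.C k) 0 0 0)

@[simp] lemma conn_v_vv (j i p : Fin n) : H.conn (.inl j) (.inl i) (.inl p) = 0 := rfl
@[simp] lemma conn_v_vz (j i : Fin n) (k : Fin m) :
    H.conn (.inl j) (.inl i) (.inr k) = 1 / 2 * H.C k i j := rfl
@[simp] lemma conn_v_zv (j i : Fin n) (k : Fin m) :
    H.conn (.inl j) (.inr k) (.inl i) = -(1 / 2 * H.C k i j) := rfl
@[simp] lemma conn_v_zz (j : Fin n) (k l : Fin m) : H.conn (.inl j) (.inr k) (.inr l) = 0 := rfl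
@[simp] lemma conn_z_vv (k : Fin m) (i j : Fin n) :
    H.conn (.inr k) (.inl i) (.inl j) = 1 / 2 * H.C k i j := rfl
@[simp] lemma conn_z_vz (k l : Fin m) (i : Fin n) : H.conn (.inr k) (.inl i) (.inr l) = 0 := rfl
@[simp] lemma conn_z_z (k l : Fin m) (c : Fin n ⊕ Fin m) :
    H.conn (.inr k) (.inr l) c = 0 := by cases c <;> rfl

lemma conn_skew (b : Fin n ⊕ Fin m) : (H.conn b)ᵀ = -H.conn b := by
  ext a c
  rcases b with j | k <;> rcases a with i | p <;> rcases c with i' | p' <;> simp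
  rw [H.skew k i' i]; ring

lemma conn_self_left (a p : Fin n ⊕ Fin m) : H.conn a a p = 0 := by
  rcases a with i | k <;> rcases p with j | l <;> simp [H.C_diag]

lemma conn_self_right (a p : Fin n ⊕ Fin m) : H.conn a p a = 0 := by
  have := congrFun (congrFun (H.conn_skew a) a) p
  rw [Matrix.transpose_apply, Matrix.neg_apply, H.conn_self_left, neg_zero] at this
  exact this

/-- The diagonal matrix which is `p` on `𝔳` and `q` on `𝔷`. -/
def blockScalar (m n : ℕ) (p q : ℝ) : Matrix (Fin n ⊕ Fin m) (Fin n ⊕ Fin m) ℝ :=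
  Matrix.diagonal (Sum.elim (fun _ => p) (fun _ => q))

lemma sum_sum_C_mul_C' (i j : Fin n) :
    ∑ k, ∑ p, H.C k i p * H.C k j p = if i = j then (m : ℝ) else 0 := by
  simp only [H.sum_C_mul_C]
  split_ifs <;> simp

lemma frameRicci_conn : frameRicci H.conn = blockScalar m n (-(m : ℝ) / 2) ((n : ℝ) / 4) := by
  ext b d
  have e : frameRicci H.conn b d
      = -∑ a, ∑ p, (H.conn d a p * H.conn a p b + (H.conn a p d - H.conn d p a) * H.conn p a b) := by
    simp only [frameRicci, Matrix.of_apply]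
    rw [← Finset.sum_neg_distrib]
    refine Finset.sum_congr rfl fun a _ => ?_
    simp only [frameCurv, Matrix.sub_apply, Matrix.mul_apply, Matrix.sum_apply,
      Matrix.smul_apply, smul_eq_mul, H.conn_self_left, zero_mul, Finset.sum_const_zero, zero_sub,
      Finset.sum_add_distrib]
    ring
  rw [e]
  rcases b with i | k <;> rcases d with j | l
  · simp [blockScalar, Fintype.sum_sum_type, Matrix.diagonal_apply]
    have hS : (if i = j then -(m : ℝ) / 2 else 0 : ℝ)
        = (-1 / 2) * ∑ k, ∑ p, H.C k i p * H.C k j p := by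
      rw [H.sum_sum_C_mul_C']; split_ifs <;> ring
    rw [hS, Finset.sum_comm (s := (Finset.univ : Finset (Fin n)))]
    simp only [← Finset.sum_neg_distrib, ← Finset.sum_add_distrib, Finset.mul_sum]
    refine Finset.sum_congr rfl fun k _ => Finset.sum_congr rfl fun p _ => ?_
    rw [H.skew k p j, H.skew k p i]
    ring
  · simp [blockScalar, Fintype.sum_sum_type]
  · simp [blockScalar, Fintype.sum_sum_type]
  · simp [blockScalar, Fintype.sum_sum_type, Matrix.diagonal_apply]
    have hS : (if k = l then (n : ℝ) / 4 else 0 : ℝ)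
        = (1 / 4) * ∑ i, ∑ p, H.C k i p * H.C l i p := by
      rw [H.sum_sum_C_mul_C]; split_ifs <;> ring
    rw [hS, Finset.sum_comm]
    simp only [← Finset.sum_neg_distrib, Finset.mul_sum]
    refine Finset.sum_congr rfl fun i _ => Finset.sum_congr rfl fun p _ => ?_
    rw [H.skew l p i]
    ring

lemma frameCov_blockScalar (p q : ℝ) (c a b : Fin n ⊕ Fin m) :
    frameCov H.conn (blockScalar m n p q) c a b
      = H.conn c a b * (blockScalar m n p q b b - blockScalar m n p q a a) := by
  simp only [frameCov, blockScalar, Matrix.sub_apply, Matrix.mul_diagonal, Matrix.diagonal_mul,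
    Matrix.diagonal_apply_eq]
  ring

/-- In the sums over frame vectors the term `∇_{e_c} e_c` vanishes, so the Laplacian is a double
commutator with the connection. -/
lemma frameBox_blockScalar (p q : ℝ) : frameBox H.conn (blockScalar m n p q)
    = blockScalar m n ((q - p) * m / 2) (-((q - p) * n / 2)) := by
  ext a b
  have e : frameBox H.conn (blockScalar m n p q) a b
      = ∑ c, ∑ e, H.conn c a e * H.conn c e b * (blockScalar m n p q a a
        + blockScalar m n p q b b - 2 * blockScalar m n p q e e) := by
    simp only [frameBox, H.conn_self_right, zero_smul, Finset.sum_const_zero, sub_zero,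
      Matrix.sum_apply]
    refine Finset.sum_congr rfl fun c _ => ?_
    rw [frameCov, Matrix.sub_apply, Matrix.mul_apply, Matrix.mul_apply, ← Finset.sum_sub_distrib]
    refine Finset.sum_congr rfl fun e _ => ?_
    rw [H.frameCov_blockScalar, H.frameCov_blockScalar]
    ring
  rw [e]
  rcases a with i | k <;> rcases b with j | l
  · simp [blockScalar, Fintype.sum_sum_type, Matrix.diagonal_apply]
    have hS : (if i = j then (q - p) * m / 2 else 0 : ℝ)
        = ((q - p) / 2) * ∑ k, ∑ p, H.C k i p * H.C k j p := by
      rw [H.sum_sum_C_mul_C']; split_ifs <;> ring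
    rw [hS, Finset.sum_comm (s := (Finset.univ : Finset (Fin n)))]
    simp only [← Finset.sum_neg_distrib, ← Finset.sum_add_distrib, Finset.mul_sum]
    refine Finset.sum_congr rfl fun k _ => Finset.sum_congr rfl fun p _ => ?_
    rw [H.skew k p j]
    ring
  · simp [blockScalar, Fintype.sum_sum_type]
  · simp [blockScalar, Fintype.sum_sum_type]
  · simp [blockScalar, Fintype.sum_sum_type, Matrix.diagonal_apply]
    have hS : (if k = l then -((q - p) * n / 2) else 0 : ℝ)
        = (-((q - p) / 2)) * ∑ i, ∑ p, H.C k i p * H.C l i p := by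
      rw [H.sum_sum_C_mul_C]; split_ifs <;> ring
    rw [hS, Finset.sum_comm]
    simp only [← Finset.sum_neg_distrib, Finset.mul_sum]
    refine Finset.sum_congr rfl fun i _ => Finset.sum_congr rfl fun p _ => ?_
    ring

lemma frameCurvAct_blockScalar (p q : ℝ) : frameCurvAct H.conn (blockScalar m n p q)
    = blockScalar m n ((q - 3 * p) * m / 4) (p * n / 4) := by
  ext a c
  have e : frameCurvAct H.conn (blockScalar m n p q) a c
      = -∑ b, ∑ e, (H.conn b a e * H.conn c e b + (H.conn c e b - H.conn b e c) * H.conn e a b)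
        * blockScalar m n p q b b := by
    simp only [frameCurvAct, Matrix.of_apply]
    rw [← Finset.sum_neg_distrib]
    refine Finset.sum_congr rfl fun b _ => ?_
    rw [Finset.sum_eq_single b (fun d _ hd => by simp [blockScalar, hd.symm]) (by simp)]
    simp only [frameCurv, Matrix.sub_apply, Matrix.mul_apply,
      Matrix.sum_apply, Matrix.smul_apply, smul_eq_mul, H.conn_self_right, mul_zero,
      Finset.sum_const_zero, zero_sub, Finset.sum_add_distrib, ← Finset.sum_mul]
    ring
  rw [e]
  rcases a with i | k <;> rcases c with j | l
  · simp [blockScalar, Fintype.sum_sum_type, Matrix.diagonal_apply]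
    have hS : (if i = j then (q - 3 * p) * m / 4 else 0 : ℝ)
        = ((q - 3 * p) / 4) * ∑ k, ∑ p, H.C k i p * H.C k j p := by
      rw [H.sum_sum_C_mul_C']; split_ifs <;> ring
    rw [hS, Finset.sum_comm (s := (Finset.univ : Finset (Fin n)))]
    simp only [← Finset.sum_neg_distrib, ← Finset.sum_add_distrib, Finset.mul_sum]
    refine Finset.sum_congr rfl fun k _ => Finset.sum_congr rfl fun p _ => ?_
    rw [H.skew k p j]
    ring
  · simp [blockScalar, Fintype.sum_sum_type]
  · simp [blockScalar, Fintype.sum_sum_type]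
  · simp [blockScalar, Fintype.sum_sum_type, Matrix.diagonal_apply]
    have hS : (if k = l then p * n / 4 else 0 : ℝ)
        = (p / 4) * ∑ i, ∑ p, H.C k i p * H.C l i p := by
      rw [H.sum_sum_C_mul_C]; split_ifs <;> ring
    rw [hS, Finset.sum_comm]
    simp only [Finset.mul_sum]
    refine Finset.sum_congr rfl fun i _ => Finset.sum_congr rfl fun p _ => ?_
    ring

/-! ### The left-invariant coframes of the two groups -/

/-- The left-invariant coframe of the generalised Heisenberg group. -/
abbrev coframe : (Fin n ⊕ Fin m → ℝ) → Matrix (Fin n ⊕ Fin m) (Fin n ⊕ Fin m) ℝ :=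
  leftCoframe H.mul (fun x => -x)

lemma coframe_eq (x : Fin n ⊕ Fin m → ℝ) : H.coframe x
    = Matrix.fromBlocks 1 0 (Matrix.of fun k j => -(1 / 2 * ∑ i, H.C k i j * x (.inl i))) 1 := by
  ext a j
  have hpd : ∀ c : Fin n ⊕ Fin m, pd j (fun y => -x c + y c) x = if c = j then 1 else 0 := by
    intro c
    rw [pd_add (by fun_prop) (by fun_prop), pd_const, pd_proj, zero_add]
  rcases a with p | k
  · have e : (fun y => H.mul (-x) y (.inl p)) = fun y => -x (.inl p) + y (.inl p) := by
      funext y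
      simp [mul, bracket]
    rw [coframe, leftCoframe, Matrix.of_apply, e, hpd]
    rcases j with j | l <;> simp [Matrix.one_apply]
  · have e : (fun y => H.mul (-x) y (.inr k)) = fun y => (-x (.inr k) + y (.inr k))
        + ∑ q, (-(1 / 2 * ∑ i, H.C k i q * x (.inl i))) * y (.inl q) := by
      funext y
      simp only [mul, bracket, bracketV, Pi.add_apply, Pi.smul_apply, Pi.neg_apply, Sum.elim_inr,
        smul_eq_mul, Function.comp]
      congr 1
      rw [Finset.sum_comm, Finset.mul_sum]
      refine Finset.sum_congr rfl fun q _ => ?_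
      rw [← neg_mul, mul_assoc, Finset.sum_mul, neg_mul, Finset.mul_sum, Finset.mul_sum,
        ← Finset.sum_neg_distrib]
      exact Finset.sum_congr rfl fun i _ => by ring
    have hq : ∀ q, pd j (fun y => (-(1 / 2 * ∑ i, H.C k i q * x (.inl i))) * y (.inl q)) x
        = (-(1 / 2 * ∑ i, H.C k i q * x (.inl i))) * if Sum.inl q = j then 1 else 0 := by
      intro q
      rw [pd_mul (by fun_prop) (by fun_prop), pd_const, pd_proj]
      ring
    rw [coframe, leftCoframe, Matrix.of_apply, e, pd_add (by fun_prop) (by fun_prop), hpd,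
      pd_sum (fun q _ => by fun_prop)]
    simp only [hq]
    rcases j with j | l <;> simp [Matrix.one_apply]

/-- The inverse of the coframe at `x` is the coframe at `-x`, because the matrix is unipotent with
a strictly triangular block that is linear in `x`. -/
lemma isInvariantCoframe :
    IsInvariantCoframe H.coframe (fun x => H.coframe (-x)) H.conn where
  contDiff := by
    rintro (p | k) (j | l) <;> simp only [coframe_eq, Matrix.fromBlocks_apply₁₁,
      Matrix.fromBlocks_apply₁₂, Matrix.fromBlocks_apply₂₁, Matrix.fromBlocks_apply₂₂,
      Matrix.of_apply] <;> fun_prop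
  diff_inv := by
    rintro (p | k) (j | l) <;> simp only [coframe_eq, Matrix.fromBlocks_apply₁₁,
      Matrix.fromBlocks_apply₁₂, Matrix.fromBlocks_apply₂₁, Matrix.fromBlocks_apply₂₂,
      Matrix.of_apply, Pi.neg_apply] <;> fun_prop
  inv_mul x := by
    simp only [coframe_eq, Matrix.fromBlocks_multiply, Matrix.mul_one, Matrix.one_mul,
      Matrix.zero_mul, Matrix.mul_zero, add_zero, zero_add]
    rw [← Matrix.fromBlocks_one]
    congr 1
    ext k j
    simp
  skew := H.conn_skew
  torsion := by
    intro x a i j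
    have hpd : ∀ k p q, pd q (fun y => -(2⁻¹ * ∑ i, H.C k i p * y (.inl i))) x
        = ∑ r, -(2⁻¹ * H.C k r p) * if Sum.inl r = q then 1 else 0 := by
      intro k p q
      have e : (fun y : Fin n ⊕ Fin m → ℝ => -(2⁻¹ * ∑ i, H.C k i p * y (.inl i)))
          = fun y => ∑ r, -(2⁻¹ * H.C k r p) * y (.inl r) := by
        funext y
        rw [Finset.mul_sum, ← Finset.sum_neg_distrib]
        exact Finset.sum_congr rfl fun r _ => by ring
      rw [e, pd_sum (fun r _ => by fun_prop)]
      refine Finset.sum_congr rfl fun r _ => ?_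
      rw [pd_mul (by fun_prop) (by fun_prop), pd_const, pd_proj]
      ring
    simp only [Matrix.add_apply, connForm_mul_apply, pdMat, Matrix.of_apply, coframe_eq]
    rcases a with p | k <;> rcases i with i | k' <;> rcases j with j | l <;>
      simp [Fintype.sum_sum_type, pd_const, hpd, Matrix.one_apply]
    · rw [add_comm]
      congr 2 <;> exact Finset.sum_congr rfl fun k _ => mul_comm _ _
    · rw [H.skew k j i]
      ring

/-! ### Ricci curvature of the two groups -/

/-- The eigenvalues of `ad A` on `𝔫`. -/
def weight (m n : ℕ) : Fin n ⊕ Fin m → ℝ := Sum.elim (fun _ => 1 / 2) (fun _ => 1)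

lemma weight_derivation (a b c : Fin n ⊕ Fin m)
    (h : H.conn b a c - H.conn c a b ≠ 0) : weight m n b + weight m n c = weight m n a := by
  rcases a with i | k <;> rcases b with j | l <;> rcases c with j' | l' <;>
    simp [weight] at h ⊢
  norm_num

/-- The `𝔫`-rows of left translation by `x⁻¹` in the extension are those of the Heisenberg group,
scaled by `e^{-d_a s}`. -/
lemma leftCoframe_ext (x : Unit ⊕ (Fin n ⊕ Fin m) → ℝ) :
    leftCoframe H.extMul extInv x = extCoframe (weight m n) H.coframe x := by
  have hm : ∀ (y : Unit ⊕ (Fin n ⊕ Fin m) → ℝ) a, H.extMul (extInv x) y (.inr a)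
      = Real.exp (-weight m n a * x (.inl ())) * H.mul (-(x ∘ .inr)) (y ∘ .inr) a := by
    intro y a
    rcases a with i | k
    · have e : -x (.inl ()) / 2 = -(1 / 2) * x (.inl ()) := by ring
      simp only [extMul, extInv, mul, bracket, weight, Sum.elim_inl, Sum.elim_inr, Pi.add_apply,
        Pi.neg_apply, Pi.smul_apply, Pi.zero_apply, Function.comp, smul_zero, add_zero, e]
      ring
    · have e : -x (.inl ()) / 2 = -(1 / 2) * x (.inl ()) := by ring
      have e2 : Real.exp (-x (.inl ()))
          = Real.exp (-(1 / 2) * x (.inl ())) * Real.exp (-(1 / 2) * x (.inl ())) := by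
        rw [← Real.exp_add]; ring_nf
      simp only [extMul, extInv, mul, bracket, bracketV, weight, Sum.elim_inl, Sum.elim_inr,
        Pi.add_apply, Pi.neg_apply, Pi.smul_apply, Function.comp, smul_eq_mul, e, neg_one_mul, e2,
        mul_add, Finset.mul_sum]
      refine congrArg₂ (· + ·) (by ring) ?_
      exact Finset.sum_congr rfl fun i _ => Finset.sum_congr rfl fun j _ => by ring
  have hdiff : ∀ a, Differentiable ℝ fun y => H.mul (-(x ∘ .inr)) y a := by
    rintro (i | k) <;> simp only [mul, bracket, bracketV, Pi.add_apply, Pi.smul_apply,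
      Sum.elim_inl, Sum.elim_inr, Function.comp, Pi.zero_apply] <;> fun_prop
  ext a j
  rcases a with u | a
  · have e : (fun y => H.extMul (extInv x) y (.inl u))
        = fun y => -x (.inl ()) + y (.inl ()) := rfl
    rw [leftCoframe, Matrix.of_apply, e, pd_add (by fun_prop) (by fun_prop), pd_const, pd_proj]
    rcases j with v | j <;> simp
  · have hd : DifferentiableAt ℝ
        (fun y : Unit ⊕ (Fin n ⊕ Fin m) → ℝ => H.mul (-(x ∘ .inr)) (y ∘ .inr) a) x :=
      (hdiff a).comp (differentiable_pi.2 fun i => differentiable_apply (Sum.inr i)) x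
    rw [leftCoframe, Matrix.of_apply, funext fun y => hm y a,
      pd_mul (differentiableAt_const _) hd, pd_const, zero_mul, zero_add]
    rcases j with v | j
    · rw [pd_comp_inr_inl v (hdiff a)]
      simp
    · rw [pd_comp_inr j (hdiff a)]
      rfl

theorem isEinstein_extMetric : IsEinstein H.extMetric := by
  have h := H.isInvariantCoframe.ext (weight m n) H.weight_derivation
  refine ⟨-((m : ℝ) + n / 4), fun x => ?_⟩
  have hg : H.extMetric = fun y => (1 : ℝ) • ((extCoframe (weight m n) H.coframe y)ᵀ
      * extCoframe (weight m n) H.coframe y) := by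
    funext y
    rw [one_smul, extMetric, leftInvariantMetric, leftCoframe_ext]
  have hR : frameRicci (extConn (weight m n) H.conn)
      = (-((m : ℝ) + n / 4)) • (1 : Matrix (Unit ⊕ (Fin n ⊕ Fin m)) _ ℝ) := by
    rw [frameRicci_extConn H.conn_skew H.conn_self_left, frameRicci_conn,
      ← Matrix.fromBlocks_one, Matrix.fromBlocks_smul, smul_zero, smul_zero]
    have h1 : ∑ a, weight m n a ^ 2 = (m : ℝ) + n / 4 := by
      simp [weight, Fintype.sum_sum_type]; ring
    have h2 : ∑ a, weight m n a = (m : ℝ) + n / 2 := by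
      simp [weight, Fintype.sum_sum_type]; ring
    rw [h1, h2]
    congr 1
    ext a b
    rcases a with i | k <;> rcases b with j | l <;>
      simp [blockScalar, weight, Matrix.diagonal_apply, Matrix.one_apply] <;> split_ifs <;> ring
  rw [hg, h.ricci_eq one_ne_zero, hR]
  simp only [one_smul]
  rw [Matrix.mul_smul, Matrix.smul_mul, Matrix.mul_one]

theorem isNilsoliton : H.IsNilsoliton := by
  refine ⟨-((m : ℝ) + n / 4), blockScalar m n ((m : ℝ) / 2 + n / 4) (m + (n : ℝ) / 2), ?_, ?_⟩
  · intro X Y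
    have hv : ∀ (p q : ℝ) (X : Fin n ⊕ Fin m → ℝ) i,
        (blockScalar m n p q).mulVec X (.inl i) = p * X (.inl i) := by
      intro p q X i; simp [blockScalar, Matrix.mulVec_diagonal]
    have hz : ∀ (p q : ℝ) (X : Fin n ⊕ Fin m → ℝ) k,
        (blockScalar m n p q).mulVec X (.inr k) = q * X (.inr k) := by
      intro p q X i; simp [blockScalar, Matrix.mulVec_diagonal]
    ext a
    rcases a with i | k
    · simp [hv, bracket]
    · simp only [Pi.add_apply, hz, bracket, Sum.elim_inr, bracketV, Function.comp, hv,
        Finset.mul_sum, ← Finset.sum_add_distrib]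
      exact Finset.sum_congr rfl fun i _ => Finset.sum_congr rfl fun j _ => by ring
  · intro x
    have hg : H.metric = fun y => (1 : ℝ) • ((H.coframe y)ᵀ * H.coframe y) := by
      funext y
      rw [one_smul]; rfl
    have hR : frameRicci H.conn = (-((m : ℝ) + n / 4)) • 1
        + blockScalar m n ((m : ℝ) / 2 + n / 4) (m + (n : ℝ) / 2) := by
      rw [frameRicci_conn]
      ext a b
      rcases a with i | k <;> rcases b with j | l <;>
        simp [blockScalar, Matrix.diagonal_apply, Matrix.one_apply] <;> split_ifs <;> ring
    rw [hg, H.isInvariantCoframe.ricci_eq one_ne_zero, hR]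
    simp only [one_smul]
    rw [Matrix.mul_add, Matrix.add_mul, Matrix.mul_smul, Matrix.smul_mul, Matrix.mul_one]

/-! ### The rescaled metric -/

lemma trace_blockScalar (p q : ℝ) : (blockScalar m n p q).trace = n * p + m * q := by
  simp [blockScalar, Matrix.trace_diagonal, Fintype.sum_sum_type]

lemma blockScalar_sq (p q : ℝ) : (blockScalar m n p q)ᵀ * blockScalar m n p q
    = blockScalar m n (p ^ 2) (q ^ 2) := by
  rw [blockScalar, Matrix.diagonal_transpose, Matrix.diagonal_mul_diagonal, blockScalar]
  congr 1
  ext a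
  rcases a with i | k <;> simp [pow_two]

/-- The constant `c = nm/2` is forced by the vanishing of the Lagrangian. -/
lemma generalisedEinstein (hm : 1 ≤ m) (hn : 1 ≤ n) {ℓ α β Λ : ℝ} (hℓ : ℓ ≠ 0)
    (hα : α + ((n : ℝ) + 4 * (m : ℝ)) / ((n : ℝ) * (m : ℝ)) * β = ℓ ^ 2)
    (hΛ : Λ = -1 / (8 * ℓ ^ 2)) :
    GeneralisedEinstein α β Λ fun x => ((n : ℝ) * m / 2 * ℓ ^ 2) • H.metric x := by
  have hn' : (n : ℝ) ≠ 0 := by positivity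
  have hm' : (m : ℝ) ≠ 0 := by positivity
  have hκ : (n : ℝ) * m / 2 * ℓ ^ 2 ≠ 0 := by positivity
  intro x μ ν
  have h := H.isInvariantCoframe.Phi_eq hκ α β x μ ν
  set κ := (n : ℝ) * m / 2 * ℓ ^ 2 with hκdef
  have hg : (fun x => κ • H.metric x) = fun y => κ • ((H.coframe y)ᵀ * H.coframe y) := rfl
  obtain rfl := eq_sub_of_add_eq hα
  rw [hg, h, frameRicci_conn, frameBox_blockScalar, frameCurvAct_blockScalar, blockScalar_sq,
    trace_blockScalar, trace_blockScalar]
  clear h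
  have key : ∀ Q : Matrix (Fin n ⊕ Fin m) (Fin n ⊕ Fin m) ℝ, Q = (-Λ * κ) • 1 →
      ((H.coframe x)ᵀ * Q * H.coframe x) μ ν
        + Λ * (κ • ((H.coframe x)ᵀ * H.coframe x)) μ ν = 0 := by
    rintro Q rfl
    rw [Matrix.mul_smul, Matrix.smul_mul, Matrix.mul_one, Matrix.smul_apply, Matrix.smul_apply,
      smul_eq_mul, smul_eq_mul]
    ring
  refine key _ ?_
  rw [hΛ, hκdef]
  ext a b
  rcases a with i | k <;> rcases b with j | l <;>
    simp only [blockScalar, Matrix.add_apply, Matrix.sub_apply, Matrix.smul_apply,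
      Matrix.diagonal_apply, Matrix.one_apply, Sum.elim_inl, Sum.elim_inr, smul_eq_mul,
      Sum.inl.injEq, Sum.inr.injEq, reduceCtorEq, if_false, mul_zero, sub_zero, add_zero]
  · split_ifs
    · field_simp
      ring
    · ring
  · split_ifs
    · field_simp
      ring
    · ring

/-- The Lagrangian of `c ℓ² g₀` is `ℓ⁻² (nm/(4c) - 1/2)²`, so it vanishes identically at
`c = nm/2`. -/
lemma actionDensity_eq_zero (hm : 1 ≤ m) (hn : 1 ≤ n) {ℓ α β Λ : ℝ} (hℓ : ℓ ≠ 0)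
    (hα : α + ((n : ℝ) + 4 * (m : ℝ)) / ((n : ℝ) * (m : ℝ)) * β = ℓ ^ 2)
    (hΛ : Λ = -1 / (8 * ℓ ^ 2)) :
    actionDensity α β Λ (fun x => ((n : ℝ) * m / 2 * ℓ ^ 2) • H.metric x) = 0 := by
  have hn' : (n : ℝ) ≠ 0 := by positivity
  have hm' : (m : ℝ) ≠ 0 := by positivity
  have hκ : (n : ℝ) * m / 2 * ℓ ^ 2 ≠ 0 := by positivity
  funext x
  have h1 := H.isInvariantCoframe.scalarCurv_eq hκ x
  have h2 := H.isInvariantCoframe.ricciSq_eq hκ x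
  rw [frameRicci_conn, trace_blockScalar] at h1
  rw [frameRicci_conn, blockScalar_sq, trace_blockScalar] at h2
  have hg : H.metric = fun y => (H.coframe y)ᵀ * H.coframe y := rfl
  obtain rfl := eq_sub_of_add_eq hα
  rw [actionDensity, hg, h1, h2, hΛ]
  refine mul_eq_zero_of_left ?_ _
  field_simp
  ring

end GeneralisedHeisenberg

end

theorem mainTheorem3 (m n : ℕ) (hm : 1 ≤ m) (hn : 1 ≤ n) (H : GeneralisedHeisenberg m n) :
    H.IsNilsoliton ∧
    ChartGeometry.IsEinstein H.extMetric ∧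
    ∃ c : ℝ, 0 < c ∧ ∀ ℓ α β Λ : ℝ, ℓ ≠ 0 →
      α + ((n : ℝ) + 4 * (m : ℝ)) / ((n : ℝ) * (m : ℝ)) * β = ℓ ^ 2 →
      Λ = -1 / (8 * ℓ ^ 2) →
      ChartGeometry.GeneralisedEinstein α β Λ (fun x => (c * ℓ ^ 2) • H.metric x) ∧
      ∀ D : Set (Fin n ⊕ Fin m → ℝ), MeasurableSet D →
        ChartGeometry.HasAction α β Λ (fun x => (c * ℓ ^ 2) • H.metric x) D 0 := by
  refine ⟨H.isNilsoliton, H.isEinstein_extMetric, (n : ℝ) * m / 2, by positivity, ?_⟩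
  intro ℓ α β Λ hℓ hα hΛ
  refine ⟨H.generalisedEinstein hm hn hℓ hα hΛ, fun D _ => ?_⟩
  rw [ChartGeometry.HasAction, H.actionDensity_eq_zero hm hn hℓ hα hΛ]
  exact ⟨integrableOn_zero, by simp⟩
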